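/- Let $p,n\ge 1$, let $\mathcal{H}_p$ be the space of $p\times p$ complex Hermitian matrices, $\mathcal{SH}_p^{++}$ the manifold of $p\times p$ Hermitian positive definite matrices of determinant $1$, with tangent spaces $T_{\Sigma}\mathcal{SH}_p^{++}=\{\xi_\Sigma\in\mathcal{H}_p:\operatorname{tr}(\Sigma^{-1}\xi_\Sigma)=0\}$, and $\mathbb{R}_{++}^n$ the manifold of vectors in $\mathbb{R}^n$ with positive entries, with tangent spaces $\mathbb{R}^n$. Equip $\mathcal{SH}_p^{++}$ with the metric $\operatorname{tr}(\Sigma^{-1}\xi_\Sigma\Sigma^{-1}\eta_\Sigma)$, equip $\mathbb{R}_{++}^n$ with the metric $\sum_i \tau_i^{-2}\,\xi_{\tau,i}\,\eta_{\tau,i}$, and equip $\mathcal{M}_{p,n}=\mathcal{SH}_p^{++}\times\mathbb{R}_{++}^n$ with the Fisher metric of the compound Gaussian distribution (normalized up to a factor): for $\theta=(\Sigma,\tau)$ and tangent vectors $\xi=(\xi_\Sigma,\xi_\tau)$, $\eta=(\eta_\Sigma,\eta_\tau)$, $$\langle\xi,\eta\rangle_\theta=\frac1p\operatorname{tr}(\Sigma^{-1}\xi_\Sigma\Sigma^{-1}\eta_\Sigma)+\frac1n\sum_{i=1}^n\frac{\xi_{\tau,i}\,\eta_{\tau,i}}{\tau_i^2}.$$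 Products, inverses, powers, exponentials and logarithms of vectors of $\mathbb{R}^n$ are taken elementwise, and $\odot$ is the elementwise product. "Interval" means an interval of $\mathbb{R}$ with more than one point. Then: (i) A curve $\gamma=(\gamma^{\mathcal{SH}},\gamma^{\mathbb{R}})$ on an interval is a geodesic of $\mathcal{M}_{p,n}$ if and only if $\gamma^{\mathcal{SH}}$ is a geodesic of $\mathcal{SH}_p^{++}$ and $\gamma^{\mathbb{R}}$ is a geodesic of $\mathbb{R}_{++}^n$. (ii) For $\theta=(\Sigma,\tau)\in\mathcal{M}_{p,n}$ and $\xi=(\xi_\Sigma,\xi_\tau)\in T_\theta\mathcal{M}_{p,n}$, the curve $$\gamma(t)=\big(\Sigma\exp(t\Sigma^{-1}\xi_\Sigma),\ \tau\odot\exp(t\,\tau^{-1}\odot\xi_\tau)\big),\qquad t\in\mathbb{R},$$ is a geodesic of $\mathcal{M}_{p,n}$ with $\gamma(0)=\theta$ and $\dot\gamma(0)=\xi$, and every geodesic on an interval containing $0$ with this initial point and velocity coincides with it there. (iii) For $\theta_0=(\Sigma_0,\tau_0)$ and $\theta_1=(\Sigma_1,\tau_1)$ in $\mathcal{M}_{p,n}$,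 the curve $$\gamma(t)=\big(\Sigma_0^{1/2}(\Sigma_0^{-1/2}\Sigma_1\Sigma_0^{-1/2})^t\,\Sigma_0^{1/2},\ \tau_0^{1-t}\odot\tau_1^{t}\big),\qquad t\in\mathbb{R},$$ is a geodesic of $\mathcal{M}_{p,n}$ with $\gamma(0)=\theta_0$ and $\gamma(1)=\theta_1$, and every geodesic on an interval containing $0$ and $1$ with these values at $0$ and $1$ coincides with it there. (iv) Any two points $\theta_0,\theta_1$ of $\mathcal{M}_{p,n}$ are joined by a $C^1$ curve in $\mathcal{M}_{p,n}$, and the Riemannian distance $\delta$ (the infimum of the lengths of such curves) satisfies $$\delta^2(\theta_0,\theta_1)=\frac1p\big\|\log(\Sigma_0^{-1/2}\Sigma_1\Sigma_0^{-1/2})\big\|_F^2+\frac1n\big\|\log(\tau_0^{-1}\odot\tau_1)\big\|_2^2,$$ with the Frobenius norm of matrices and the Euclidean norm of vectors. -/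

import Mathlib

open Set
open scoped Matrix Matrix.Norms.Frobenius ComplexOrder ContDiff

noncomputable section

namespace CompoundGaussian

section Riemannian

variable {E : Type*} [NormedAddCommGroup E] [NormedSpace ℝ E]

/-- The Christoffel symbols of the Levi-Civita connection of a metric `g` on (an open part of) a
vector space, lowered with `g`: by the Koszul formula for constant vector fields,
`g x (Γ x (u, v)) w = 1/2 (D_u g(v, w) + D_v g(u, w) - D_w g(u, v))` at `x`. -/
def christoffel (g : E → E → E → ℝ) (x u v w : E) : ℝ :=
  (1 / 2) * (lineDeriv ℝ (fun y => g y v w) x u + lineDeriv ℝ (fun y => g y u w) x v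
    - lineDeriv ℝ (fun y => g y u v) x w)

/-- The `g`-inner product with `w` of the covariant acceleration
`γ'' + Γ (γ', γ')` of the curve `γ`, defined on the interval `J`, at time `t`. -/
def accelInner (g : E → E → E → ℝ) (γ : ℝ → E) (J : Set ℝ) (t : ℝ) (w : E) : ℝ :=
  g (γ t) (derivWithin (derivWithin γ J) J t) w
    + christoffel g (γ t) (derivWithin γ J t) (derivWithin γ J t) w

/-- `γ` restricted to the interval `J` is a geodesic of the embedded submanifold `S` with tangent
spaces `T` and metric `g`: it is a smooth curve in `S` whose acceleration for the Levi-Civita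
connection of `S` vanishes. The Levi-Civita connection of `S` is the tangential part of the
ambient one, so this says that the ambient covariant acceleration is `g`-orthogonal
to `T (γ t)`. -/
def IsGeodesicOn (S : Set E) (T : E → Set E) (g : E → E → E → ℝ) (γ : ℝ → E) (J : Set ℝ) : Prop :=
  ContDiffOn ℝ ∞ γ J ∧ MapsTo γ J S ∧ ∀ t ∈ J, ∀ w ∈ T (γ t), accelInner g γ J t w = 0

/-- The length of the curve `γ` on `[0, 1]` for the metric `g`. -/
def curveLength (g : E → E → E → ℝ) (γ : ℝ → E) : ℝ :=
  ∫ t in (0 : ℝ)..1,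
    √(g (γ t) (derivWithin γ (Icc 0 1) t) (derivWithin γ (Icc 0 1) t))

/-- The lengths of the `C^1` curves in `S` from `x` to `y`. -/
def curveLengths (S : Set E) (g : E → E → E → ℝ) (x y : E) : Set ℝ :=
  {L | ∃ γ : ℝ → E, ContDiffOn ℝ 1 γ (Icc 0 1) ∧ MapsTo γ (Icc 0 1) S ∧ γ 0 = x ∧ γ 1 = y ∧
    curveLength g γ = L}

/-- The Riemannian distance on the connected submanifold `S` with metric `g`. -/
def riemannianDist (S : Set E) (g : E → E → E → ℝ) (x y : E) : ℝ :=
  sInf (curveLengths S g x y)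

end Riemannian

variable {p n : ℕ}

/-- Hermitian positive definite matrices of determinant one. -/
def SHPD (p : ℕ) : Set (Matrix (Fin p) (Fin p) ℂ) :=
  {A | A.PosDef ∧ A.det = 1}

/-- The tangent space to `SHPD p` at `A`. -/
def tangentSHPD (A : Matrix (Fin p) (Fin p) ℂ) : Set (Matrix (Fin p) (Fin p) ℂ) :=
  {ξ | ξ.IsHermitian ∧ (A⁻¹ * ξ).trace = 0}

/-- The affine-invariant metric `tr (A⁻¹ ξ A⁻¹ η)` (a real number for Hermitian arguments). -/
def metricHPD (A ξ η : Matrix (Fin p) (Fin p) ℂ) : ℝ :=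
  (A⁻¹ * ξ * A⁻¹ * η).trace.re

/-- Vectors with positive entries. -/
def PosVec (n : ℕ) : Set (Fin n → ℝ) := {τ | ∀ i, 0 < τ i}

/-- The tangent space to `PosVec n`: all of `ℝ^n`. -/
def tangentPosVec (_τ : Fin n → ℝ) : Set (Fin n → ℝ) := univ

/-- The metric `(ξ ⊙ τ⁻¹)ᵀ (η ⊙ τ⁻¹)` on positive vectors. -/
def metricPosVec (τ ξ η : Fin n → ℝ) : ℝ := ∑ i, (ξ i * (τ i)⁻¹) * (η i * (τ i)⁻¹)

/-- The vector space containing the parameters `θ = (Σ, τ)`. -/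
abbrev Param (p n : ℕ) : Type := Matrix (Fin p) (Fin p) ℂ × (Fin n → ℝ)

/-- The parameter manifold. -/
def paramManifold (p n : ℕ) : Set (Param p n) := SHPD p ×ˢ PosVec n

/-- The tangent space to the parameter manifold at `θ`. -/
def tangentParam (θ : Param p n) : Set (Param p n) := tangentSHPD θ.1 ×ˢ tangentPosVec θ.2

/-- The Fisher information metric of the compound Gaussian distribution
(normalized up to a factor). -/
def fisherMetric (θ ξ η : Param p n) : ℝ :=
  (1 / (p : ℝ)) * metricHPD θ.1 ξ.1 η.1 + (1 / (n : ℝ)) * metricPosVec θ.2 ξ.2 η.2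

/-- Real power of a Hermitian positive definite matrix (functional calculus). -/
def hpow (A : Matrix (Fin p) (Fin p) ℂ) (s : ℝ) : Matrix (Fin p) (Fin p) ℂ :=
  cfc (fun x : ℝ => x ^ s) A

/-- Logarithm of a Hermitian positive definite matrix (functional calculus). -/
def hlog (A : Matrix (Fin p) (Fin p) ℂ) : Matrix (Fin p) (Fin p) ℂ := cfc Real.log A

/-- `Σ₀^(-1/2) Σ₁ Σ₀^(-1/2)`. -/
def whiten (A B : Matrix (Fin p) (Fin p) ℂ) : Matrix (Fin p) (Fin p) ℂ :=
  hpow A (-(1 / 2)) * B * hpow A (-(1 / 2))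

/-- `t ↦ (Σ exp (t Σ⁻¹ ξ_Σ), τ ⊙ exp (t τ⁻¹ ⊙ ξ_τ))`. -/
def expCurve (θ ξ : Param p n) (t : ℝ) : Param p n :=
  (θ.1 * NormedSpace.exp (t • (θ.1⁻¹ * ξ.1)),
    fun i => θ.2 i * Real.exp (t * ((θ.2 i)⁻¹ * ξ.2 i)))

/-- `t ↦ (Σ₀^(1/2) (Σ₀^(-1/2) Σ₁ Σ₀^(-1/2))^t Σ₀^(1/2), τ₀^(1-t) ⊙ τ₁^t)`. -/
def joinCurve (θ₀ θ₁ : Param p n) (t : ℝ) : Param p n :=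
  (hpow θ₀.1 (1 / 2) * hpow (whiten θ₀.1 θ₁.1) t * hpow θ₀.1 (1 / 2),
    fun i => θ₀.2 i ^ (1 - t) * θ₁.2 i ^ t)

end CompoundGaussian

end

open CompoundGaussian

noncomputable section

namespace CompoundGaussian

/-! ### Functional calculus of Hermitian matrices, whitening and the trace inner product -/

section Spectral

variable {p : ℕ} {A B : Matrix (Fin p) (Fin p) ℂ}

/-! The Fisher metric is a sum of two terms, each living on one factor, so its Christoffel symbols
split. Testing the acceleration against `(w, 0)` and `(0, w)` separates the geodesic condition
(`isGeodesicOn_fisherMetric_iff`).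

On the matrix factor the ambient covariant acceleration is `γ'' - γ' γ⁻¹ γ'`. A geodesic of `SHPD p`
only makes it orthogonal to the tangent space, but differentiating `tr (γ⁻¹ γ') = 0` shows that it
is also tangent, hence zero (`geodesic_equation_SHPD`). The equation says that `γ⁻¹ γ'` is a
constant `C`, so `γ t = γ 0 * exp (t C)`; the positive vectors behave the same way entry by entry.
Whitening by `Σ₀^(-1/2)` turns these exponentials into exponentials of Hermitian matrices, where the
logarithm inverts the exponential. This identifies `joinCurve` as a geodesic and gives uniqueness
for prescribed endpoints.

For the distance, `joinCurve` has constant speed, the square root of `logEnergy`. Conversely, along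
any curve from `θ₀` the function `E t = logEnergy θ₀ (γ t)` satisfies `E' ≤ 2 √E · speed` by
Cauchy–Schwarz, and integration bounds the length below by `√(E 1)`. The delicate point is the
derivative of `‖log X‖²`: the double spectral expansion `tr (f(A) g(B)) = ∑ w i j f(a i) g(b j)`
with nonnegative weights lifts a scalar Taylor estimate for `log ^ 2` to matrices
(`abs_norm_hlog_sq_taylor_le`). -/

theorem continuousOn_real_spectrum (f : ℝ → ℝ) (A : Matrix (Fin p) (Fin p) ℂ) :
    ContinuousOn f (spectrum ℝ A) :=
  A.finite_real_spectrum.continuousOn f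

theorem spectrum_pos_of_posDef (hA : A.PosDef) : ∀ x ∈ spectrum ℝ A, 0 < x := by
  intro x hx
  rw [hA.isHermitian.spectrum_real_eq_range_eigenvalues] at hx
  obtain ⟨i, rfl⟩ := hx
  exact hA.eigenvalues_pos i

theorem isHermitian_cfc (f : ℝ → ℝ) (A : Matrix (Fin p) (Fin p) ℂ) :
    (cfc f A).IsHermitian :=
  cfc_predicate (p := IsSelfAdjoint) f A

theorem cfc_mul_of_matrix (f g : ℝ → ℝ) (A : Matrix (Fin p) (Fin p) ℂ) :
    cfc f A * cfc g A = cfc (fun x => f x * g x) A :=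
  (cfc_mul f g A (continuousOn_real_spectrum f A) (continuousOn_real_spectrum g A)).symm

theorem trace_cfc (hA : A.IsHermitian) (f : ℝ → ℝ) :
    (cfc f A).trace = ∑ i, (f (hA.eigenvalues i) : ℂ) := by
  rw [hA.cfc_eq, Matrix.IsHermitian.cfc, Unitary.conjStarAlgAut_apply, Matrix.trace_mul_cycle,
    Unitary.coe_star_mul_self, one_mul, Matrix.trace_diagonal]
  rfl

theorem det_cfc (hA : A.IsHermitian) (f : ℝ → ℝ) :
    (cfc f A).det = ∏ i, (f (hA.eigenvalues i) : ℂ) := by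
  rw [hA.cfc_eq, Matrix.IsHermitian.cfc, Unitary.conjStarAlgAut_apply, Matrix.det_mul_right_comm,
    Unitary.mul_star_self_of_mem hA.eigenvectorUnitary.2, one_mul, Matrix.det_diagonal]
  rfl

theorem exp_eq_cfc (hA : A.IsHermitian) : NormedSpace.exp A = cfc Real.exp A :=
  (@CFC.real_exp_eq_normedSpace_exp (Matrix (Fin p) (Fin p) ℂ) _ _ _
    Matrix.IsHermitian.instContinuousFunctionalCalculus A hA).symm

theorem det_exp_of_isHermitian (hA : A.IsHermitian) :
    (NormedSpace.exp A).det = Complex.exp A.trace := by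
  have h : A.trace = ∑ i, (hA.eigenvalues i : ℂ) := hA.trace_eq_sum_eigenvalues
  rw [exp_eq_cfc hA, det_cfc hA, h, Complex.exp_sum]
  simp

theorem isHermitian_smul_real (t : ℝ) (hA : A.IsHermitian) : (t • A).IsHermitian := by
  rw [Matrix.IsHermitian, Matrix.conjTranspose_smul, hA.eq, star_trivial]

theorem posDef_exp (hA : A.IsHermitian) : (NormedSpace.exp A).PosDef := by
  have h : NormedSpace.exp A = star (NormedSpace.exp ((1 / 2 : ℝ) • A)) *
      NormedSpace.exp ((1 / 2 : ℝ) • A) := by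
    have h1 := isHermitian_smul_real (1 / 2) hA
    rw [Matrix.star_eq_conjTranspose, h1.exp.eq, ← Matrix.exp_add_of_commute _ _ (Commute.refl _),
      ← add_smul]
    norm_num
  rw [h, Matrix.star_eq_conjTranspose]
  apply Matrix.PosDef.conjTranspose_mul_self
  exact Matrix.mulVec_injective_of_isUnit (Matrix.isUnit_exp _)

theorem isHermitian_hlog (A : Matrix (Fin p) (Fin p) ℂ) : (hlog A).IsHermitian :=
  isHermitian_cfc _ _

/-- On the positive spectrum `x ^ t = exp (t log x)`. This is what makes `joinCurve` an instance of
`expCurve`. -/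
theorem hpow_eq_exp (hA : A.PosDef) (t : ℝ) : hpow A t = NormedSpace.exp (t • hlog A) := by
  rw [exp_eq_cfc (isHermitian_smul_real t (isHermitian_hlog A)), hlog, hpow,
    ← cfc_smul t Real.log A (continuousOn_real_spectrum _ _),
    ← cfc_comp' Real.exp (fun x => t • Real.log x) A
      (by exact Real.continuous_exp.continuousOn) (continuousOn_real_spectrum _ _)
      (by exact hA.isHermitian)]
  refine cfc_congr fun x hx => ?_
  simp only [smul_eq_mul]
  rw [Real.rpow_def_of_pos (spectrum_pos_of_posDef hA x hx), mul_comm]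

theorem hpow_one (hA : A.IsHermitian) : hpow A 1 = A := by
  simp only [hpow, Real.rpow_one]
  exact cfc_id' ℝ A hA

theorem hpow_zero (hA : A.IsHermitian) : hpow A 0 = 1 := by
  simp only [hpow, Real.rpow_zero]
  exact cfc_const_one ℝ A hA

theorem isHermitian_hpow (A : Matrix (Fin p) (Fin p) ℂ) (t : ℝ) : (hpow A t).IsHermitian :=
  isHermitian_cfc _ _

theorem hpow_mul_hpow (hA : A.PosDef) (s t : ℝ) : hpow A s * hpow A t = hpow A (s + t) := by
  rw [hpow, hpow, cfc_mul_of_matrix, hpow]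
  exact cfc_congr fun x hx => (Real.rpow_add (spectrum_pos_of_posDef hA x hx) s t).symm

theorem hlog_exp (hA : A.IsHermitian) : hlog (NormedSpace.exp A) = A :=
  @CFC.log_exp (Matrix (Fin p) (Fin p) ℂ) _ _ _
    Matrix.IsHermitian.instContinuousFunctionalCalculus A hA

theorem half_mul_half (hA : A.PosDef) : hpow A (1 / 2) * hpow A (1 / 2) = A := by
  rw [hpow_mul_hpow hA, add_halves, hpow_one hA.isHermitian]

theorem half_mul_neg_half (hA : A.PosDef) : hpow A (1 / 2) * hpow A (-(1 / 2)) = 1 := by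
  rw [hpow_mul_hpow hA, add_neg_cancel, hpow_zero hA.isHermitian]

theorem neg_half_mul_half (hA : A.PosDef) : hpow A (-(1 / 2)) * hpow A (1 / 2) = 1 := by
  rw [hpow_mul_hpow hA, neg_add_cancel, hpow_zero hA.isHermitian]

theorem neg_half_mul_neg_half (hA : A.PosDef) :
    hpow A (-(1 / 2)) * hpow A (-(1 / 2)) = A⁻¹ := by
  refine (Matrix.inv_eq_left_inv ?_).symm
  nth_rw 3 [← half_mul_half hA]
  rw [mul_assoc, ← mul_assoc _ (hpow A (1 / 2)), neg_half_mul_half hA, one_mul,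
    neg_half_mul_half hA]

theorem isUnit_hpow (hA : A.PosDef) (t : ℝ) : IsUnit (hpow A t) := by
  rw [hpow_eq_exp hA]
  exact Matrix.isUnit_exp _

theorem posDef_conj_of_isUnit {P : Matrix (Fin p) (Fin p) ℂ} (hP : P.IsHermitian) (hu : IsUnit P)
    (hB : B.PosDef) : (P * B * P).PosDef := by
  have h := (Matrix.IsUnit.posDef_star_left_conjugate_iff (x := B) hu).2 hB
  rwa [Matrix.star_eq_conjTranspose, hP.eq] at h

theorem isHermitian_conj {P : Matrix (Fin p) (Fin p) ℂ} (hP : P.IsHermitian)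
    (hB : B.IsHermitian) : (P * B * P).IsHermitian := by
  simp only [Matrix.IsHermitian, Matrix.conjTranspose_mul, hP.eq, hB.eq, mul_assoc]

theorem posDef_whiten (hA : A.PosDef) (hB : B.PosDef) : (whiten A B).PosDef :=
  posDef_conj_of_isUnit (isHermitian_hpow _ _) (isUnit_hpow hA _) hB

theorem half_conj_whiten (hA : A.PosDef) (B : Matrix (Fin p) (Fin p) ℂ) :
    hpow A (1 / 2) * whiten A B * hpow A (1 / 2) = B := by
  rw [whiten, mul_assoc, mul_assoc, neg_half_mul_half hA, mul_one, ← mul_assoc,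
    half_mul_neg_half hA, one_mul]

theorem whiten_half_conj (hA : A.PosDef) (B : Matrix (Fin p) (Fin p) ℂ) :
    whiten A (hpow A (1 / 2) * B * hpow A (1 / 2)) = B := by
  rw [whiten, mul_assoc, mul_assoc, half_mul_neg_half hA, mul_one, ← mul_assoc,
    neg_half_mul_half hA, one_mul]

theorem trace_whiten (hA : A.PosDef) (B : Matrix (Fin p) (Fin p) ℂ) :
    (whiten A B).trace = (A⁻¹ * B).trace := by
  rw [whiten, Matrix.trace_mul_cycle, neg_half_mul_neg_half hA]

theorem det_whiten (hA : A ∈ SHPD p) (hB : B ∈ SHPD p) : (whiten A B).det = 1 := by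
  have h := congrArg Matrix.det (half_conj_whiten hA.1 B)
  have h2 := congrArg Matrix.det (half_mul_half hA.1)
  rw [Matrix.det_mul, Matrix.det_mul, hB.2] at h
  rw [Matrix.det_mul, hA.2] at h2
  linear_combination h - (whiten A B).det * h2

theorem trace_mul_self_of_isHermitian (hA : A.IsHermitian) : (A * A).trace.re = ‖A‖ ^ 2 := by
  have h : ‖A‖ ^ 2 = ∑ i, ∑ j, ‖A i j‖ ^ 2 := by
    have hnn : 0 ≤ ∑ i, ∑ j, ‖A i j‖ ^ (2 : ℝ) := by positivity
    rw [Matrix.frobenius_norm_def, ← Real.sqrt_eq_rpow, Real.sq_sqrt hnn]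
    simp
  rw [h, Matrix.trace, Complex.re_sum]
  refine Finset.sum_congr rfl fun i _ => ?_
  rw [Matrix.diag_apply, Matrix.mul_apply, Complex.re_sum]
  refine Finset.sum_congr rfl fun j _ => ?_
  rw [← hA.apply j i, Complex.sq_norm, Complex.normSq_apply]
  simp

/-- By cyclicity of the trace, whitening carries the metric at `A` to the Frobenius product;
positivity and Cauchy–Schwarz are inherited from there. -/
theorem metricHPD_eq_whiten (hA : A.PosDef) (ξ η : Matrix (Fin p) (Fin p) ℂ) :
    metricHPD A ξ η = (whiten A ξ * whiten A η).trace.re := by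
  have h : (whiten A ξ * whiten A η).trace = (A⁻¹ * ξ * A⁻¹ * η).trace := by
    simp only [whiten, ← neg_half_mul_neg_half hA, ← mul_assoc]
    rw [Matrix.trace_mul_comm]
    simp only [← mul_assoc]
  rw [metricHPD, h]

theorem metricHPD_self (hA : A.PosDef) {ξ : Matrix (Fin p) (Fin p) ℂ} (hξ : ξ.IsHermitian) :
    metricHPD A ξ ξ = ‖whiten A ξ‖ ^ 2 := by
  exact (metricHPD_eq_whiten hA ξ ξ).trans
    (trace_mul_self_of_isHermitian (isHermitian_conj (isHermitian_hpow _ _) hξ))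

theorem eq_zero_of_metricHPD_self (hA : A.PosDef) {ξ : Matrix (Fin p) (Fin p) ℂ}
    (hξ : ξ.IsHermitian) (h : metricHPD A ξ ξ = 0) : ξ = 0 := by
  rw [metricHPD_self hA hξ, sq_eq_zero_iff, norm_eq_zero] at h
  rw [← half_conj_whiten hA ξ, h, mul_zero, zero_mul]

theorem trace_mul_le_norm_mul_norm (hA : A.IsHermitian) (hB : B.IsHermitian) :
    (A * B).trace.re ≤ ‖A‖ * ‖B‖ := by
  -- The quadratic is `‖s • A + B‖ ^ 2`; its discriminant gives Cauchy–Schwarz.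
  have key : ∀ s : ℝ, 0 ≤ ‖A‖ ^ 2 * (s * s) + 2 * (A * B).trace.re * s + ‖B‖ ^ 2 := by
    intro s
    have hH : (s • A + B).IsHermitian := (isHermitian_smul_real s hA).add hB
    have h := trace_mul_self_of_isHermitian hH
    have h2 : ((s • A + B) * (s • A + B)).trace.re =
        (s * s) * (A * A).trace.re + s * (A * B).trace.re + s * (B * A).trace.re
          + (B * B).trace.re := by
      simp only [add_mul, mul_add, smul_mul_assoc, mul_smul_comm, Matrix.trace_add,
        Matrix.trace_smul, Complex.add_re, Complex.real_smul, Complex.re_ofReal_mul]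
      ring
    rw [h2, trace_mul_self_of_isHermitian hA, trace_mul_self_of_isHermitian hB,
      Matrix.trace_mul_comm B A] at h
    nlinarith [sq_nonneg ‖s • A + B‖]
  have hd := discrim_le_zero key
  rw [discrim] at hd
  refine le_of_abs_le (abs_le_of_sq_le_sq (by nlinarith) (by positivity))

/-- Simultaneous spectral expansion of traces of functions of two Hermitian matrices. -/
theorem exists_trace_cfc_mul_cfc (hA : A.IsHermitian) (hB : B.IsHermitian) :
    ∃ w : Fin p → Fin p → ℝ, (∀ i j, 0 ≤ w i j) ∧ ∀ f g : ℝ → ℝ,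
      (cfc f A * cfc g B).trace.re =
        ∑ i, ∑ j, w i j * (f (hA.eigenvalues i) * g (hB.eigenvalues j)) := by
  set U : Matrix (Fin p) (Fin p) ℂ := hA.eigenvectorUnitary.1
  set V : Matrix (Fin p) (Fin p) ℂ := hB.eigenvectorUnitary.1
  -- The weights are the squared overlaps of the two eigenbases, independent of `f` and `g`.
  refine ⟨fun i j => Complex.normSq ((star U * V) i j), fun _ _ => Complex.normSq_nonneg _,
    fun f g => ?_⟩
  set D : Matrix (Fin p) (Fin p) ℂ := Matrix.diagonal fun i => (f (hA.eigenvalues i) : ℂ)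
  set F : Matrix (Fin p) (Fin p) ℂ := Matrix.diagonal fun i => (g (hB.eigenvalues i) : ℂ)
  have hf : cfc f A = U * D * star U := by
    rw [hA.cfc_eq, Matrix.IsHermitian.cfc, Unitary.conjStarAlgAut_apply]; rfl
  have hg : cfc g B = V * F * star V := by
    rw [hB.cfc_eq, Matrix.IsHermitian.cfc, Unitary.conjStarAlgAut_apply]; rfl
  have h : (cfc f A * cfc g B).trace = ((D * (star U * V)) * (F * star (star U * V))).trace := by
    rw [hf, hg, star_mul, star_star]
    simp only [mul_assoc]
    rw [Matrix.trace_mul_comm]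
    simp only [mul_assoc]
  rw [h, Matrix.trace, Complex.re_sum]
  refine Finset.sum_congr rfl fun i _ => ?_
  rw [Matrix.diag_apply, Matrix.mul_apply, Complex.re_sum]
  refine Finset.sum_congr rfl fun j _ => ?_
  rw [Matrix.diagonal_mul, Matrix.diagonal_mul, Matrix.star_apply]
  have key : ∀ (a b : ℝ) (z : ℂ),
      ((a : ℂ) * z * (b * star z)).re = Complex.normSq z * (a * b) := by
    intro a b z
    simp [Complex.normSq_apply]
    ring
  exact key _ _ _

end Spectral

/-! ### Christoffel symbols and the splitting of the geodesic condition -/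

section Calculus

variable {p n : ℕ}

/-- The topology of the Frobenius norm, preferred in this section to the (equal) entrywise one. -/
local instance frobeniusTopology : TopologicalSpace (Matrix (Fin p) (Fin p) ℂ) :=
  PseudoMetricSpace.toUniformSpace.toTopologicalSpace

/-- The real part of the trace as a continuous linear functional. -/
def reTrace (p : ℕ) : Matrix (Fin p) (Fin p) ℂ →L[ℝ] ℝ :=
  LinearMap.toContinuousLinearMap
    { toFun := fun M => M.trace.re
      map_add' := fun M N => by simp
      map_smul' := fun c M => by simp }

theorem hasDerivWithinAt_reTrace {f : ℝ → Matrix (Fin p) (Fin p) ℂ}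
    {f' : Matrix (Fin p) (Fin p) ℂ} {s : Set ℝ} {t : ℝ} (hf : HasDerivWithinAt f f' s t) :
    HasDerivWithinAt (fun r => (f r).trace.re) f'.trace.re s t :=
  (reTrace p).hasFDerivAt.comp_hasDerivWithinAt t hf

theorem hasDerivWithinAt_matrix_inv {f : ℝ → Matrix (Fin p) (Fin p) ℂ}
    {f' : Matrix (Fin p) (Fin p) ℂ} {s : Set ℝ} {t : ℝ} (hf : HasDerivWithinAt f f' s t)
    (hu : IsUnit (f t)) :
    HasDerivWithinAt (fun r => (f r)⁻¹) (-((f t)⁻¹ * f' * (f t)⁻¹)) s t := by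
  have : CompleteSpace (Matrix (Fin p) (Fin p) ℂ) := FiniteDimensional.complete ℝ _
  obtain ⟨u, hu⟩ := hu
  have h1 : HasFDerivAt Ring.inverse _ (f t) := hu ▸ hasFDerivAt_ringInverse (𝕜 := ℝ) u
  have h := h1.comp_hasDerivWithinAt t hf
  simp only [Matrix.nonsing_inv_eq_ringInverse]
  convert! h using 1
  rw [← hu, Ring.inverse_unit]
  simp

theorem contDiffWithinAt_matrix_inv {f : ℝ → Matrix (Fin p) (Fin p) ℂ} {k : WithTop ℕ∞}
    {s : Set ℝ} {t : ℝ} (hf : ContDiffWithinAt ℝ k f s t) (hu : IsUnit (f t)) :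
    ContDiffWithinAt ℝ k (fun r => (f r)⁻¹) s t := by
  have : CompleteSpace (Matrix (Fin p) (Fin p) ℂ) := FiniteDimensional.complete ℝ _
  obtain ⟨u, hu⟩ := hu
  have h1 : ContDiffAt ℝ k Ring.inverse (f t) := hu ▸ contDiffAt_ringInverse ℝ u
  simp only [Matrix.nonsing_inv_eq_ringInverse]
  exact h1.comp_contDiffWithinAt t hf

/-- Each of the two factors `y⁻¹` contributes `-x⁻¹ u x⁻¹`. -/
theorem hasLineDerivAt_metricHPD {x : Matrix (Fin p) (Fin p) ℂ} (hx : IsUnit x)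
    (u v w : Matrix (Fin p) (Fin p) ℂ) :
    HasLineDerivAt ℝ (fun y => metricHPD y v w)
      (-((x⁻¹ * u * x⁻¹ * v * x⁻¹ * w).trace.re + (x⁻¹ * v * x⁻¹ * u * x⁻¹ * w).trace.re)) x u := by
  have h0 : HasDerivAt (fun t : ℝ => x + t • u) u 0 := by
    convert! ((hasDerivAt_id (0 : ℝ)).smul_const u).const_add x using 1
    rw [one_smul]
  have hi := hasDerivWithinAt_matrix_inv (s := univ) (t := 0) h0.hasDerivWithinAt (by simpa using hx)
  have hm := (((hi.mul_const v).mul hi).mul_const w)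
  have h := hasDerivWithinAt_reTrace hm
  rw [hasDerivWithinAt_univ] at h
  rw [HasLineDerivAt]
  convert! h using 1
  simp only [zero_smul, add_zero, neg_mul, mul_neg, add_mul, Matrix.trace_add,
    Matrix.trace_neg, Complex.neg_re, Complex.add_re, mul_assoc]
  ring

/-- By cyclicity every Koszul derivative equals `-2 T`, with `T` the trace on the right, and two of
them minus one remain. -/
theorem christoffel_metricHPD_self {x : Matrix (Fin p) (Fin p) ℂ} (hx : IsUnit x)
    (v w : Matrix (Fin p) (Fin p) ℂ) :
    christoffel metricHPD x v v w = -(x⁻¹ * v * x⁻¹ * v * x⁻¹ * w).trace.re := by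
  rw [christoffel, (hasLineDerivAt_metricHPD hx v v w).lineDeriv,
    (hasLineDerivAt_metricHPD hx w v v).lineDeriv]
  have h1 : (x⁻¹ * w * x⁻¹ * v * x⁻¹ * v).trace = (x⁻¹ * v * x⁻¹ * v * x⁻¹ * w).trace := by
    rw [mul_assoc (x⁻¹ * w), mul_assoc (x⁻¹ * w), mul_assoc (x⁻¹ * w), Matrix.trace_mul_comm]
    simp only [mul_assoc]
  have h2 : (x⁻¹ * v * x⁻¹ * w * x⁻¹ * v).trace = (x⁻¹ * v * x⁻¹ * v * x⁻¹ * w).trace := by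
    rw [mul_assoc _ x⁻¹ v, Matrix.trace_mul_comm]
    simp only [mul_assoc]
  rw [h1, h2]
  ring

theorem accelInner_metricHPD {γ : ℝ → Matrix (Fin p) (Fin p) ℂ} {J : Set ℝ} {t : ℝ}
    (hu : IsUnit (γ t)) (w : Matrix (Fin p) (Fin p) ℂ) :
    accelInner metricHPD γ J t w = metricHPD (γ t) (derivWithin (derivWithin γ J) J t -
      derivWithin γ J t * (γ t)⁻¹ * derivWithin γ J t) w := by
  rw [accelInner, christoffel_metricHPD_self hu, metricHPD, metricHPD]
  simp only [mul_sub, sub_mul, Matrix.trace_sub, Complex.sub_re, mul_assoc]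
  ring

theorem hasLineDerivAt_metricPosVec {x : Fin n → ℝ} (hx : ∀ i, x i ≠ 0) (u v w : Fin n → ℝ) :
    HasLineDerivAt ℝ (fun y => metricPosVec y v w)
      (∑ i, -(2 * u i * v i * w i * ((x i)⁻¹) ^ 3)) x u := by
  rw [HasLineDerivAt]
  simp only [metricPosVec]
  refine HasDerivAt.fun_sum fun i _ => ?_
  have h0 : HasDerivAt (fun t : ℝ => (x + t • u) i) (u i) 0 := by
    simpa using! ((hasDerivAt_id (0 : ℝ)).mul_const (u i)).const_add (x i)
  have hi := h0.inv (by simpa using hx i)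
  convert! (hi.const_mul (v i)).mul (hi.const_mul (w i)) using 1
  have := hx i
  simp
  field_simp
  ring

theorem christoffel_metricPosVec_self {x : Fin n → ℝ} (hx : ∀ i, x i ≠ 0) (v w : Fin n → ℝ) :
    christoffel metricPosVec x v v w = ∑ i, -(v i ^ 2 * w i * ((x i)⁻¹) ^ 3) := by
  rw [christoffel, (hasLineDerivAt_metricPosVec hx v v w).lineDeriv,
    (hasLineDerivAt_metricPosVec hx w v v).lineDeriv, ← Finset.sum_add_distrib,
    ← Finset.sum_sub_distrib, Finset.mul_sum]
  exact Finset.sum_congr rfl fun i _ => by ring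

theorem accelInner_metricPosVec {γ : ℝ → Fin n → ℝ} {J : Set ℝ} {t : ℝ}
    (hx : ∀ i, γ t i ≠ 0) (w : Fin n → ℝ) :
    accelInner metricPosVec γ J t w = metricPosVec (γ t) (fun i =>
      derivWithin (derivWithin γ J) J t i - derivWithin γ J t i ^ 2 * (γ t i)⁻¹) w := by
  rw [accelInner, christoffel_metricPosVec_self hx, metricPosVec, metricPosVec,
    ← Finset.sum_add_distrib]
  exact Finset.sum_congr rfl fun i _ => by ring

theorem hasLineDerivAt_fisherMetric {x : Param p n} (hx : IsUnit x.1) (hx2 : ∀ i, x.2 i ≠ 0)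
    (u v w : Param p n) :
    HasLineDerivAt ℝ (fun y => fisherMetric y v w)
      ((1 / (p : ℝ)) * lineDeriv ℝ (fun y => metricHPD y v.1 w.1) x.1 u.1 +
        (1 / (n : ℝ)) * lineDeriv ℝ (fun y => metricPosVec y v.2 w.2) x.2 u.2) x u := by
  have h1 := hasLineDerivAt_metricHPD hx u.1 v.1 w.1
  have h2 := hasLineDerivAt_metricPosVec hx2 u.2 v.2 w.2
  rw [h1.lineDeriv, h2.lineDeriv]
  exact (HasDerivAt.const_mul (1 / (p : ℝ)) h1).add (HasDerivAt.const_mul (1 / (n : ℝ)) h2)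

theorem christoffel_fisherMetric {x : Param p n} (hx : IsUnit x.1) (hx2 : ∀ i, x.2 i ≠ 0)
    (u v w : Param p n) :
    christoffel fisherMetric x u v w = (1 / (p : ℝ)) * christoffel metricHPD x.1 u.1 v.1 w.1 +
      (1 / (n : ℝ)) * christoffel metricPosVec x.2 u.2 v.2 w.2 := by
  simp only [christoffel, (hasLineDerivAt_fisherMetric hx hx2 _ _ _).lineDeriv]
  ring

theorem uniqueDiffOn_of_ordConnected {J : Set ℝ} (hJ : J.OrdConnected) (hn : J.Nontrivial) :
    UniqueDiffOn ℝ J := by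
  obtain ⟨a, ha, b, hb, hab⟩ := hn.exists_lt
  refine uniqueDiffOn_convex hJ.convex ⟨(a + b) / 2, ?_⟩
  exact interior_mono (hJ.out ha hb)
    (by rw [interior_Icc]; exact ⟨by linarith, by linarith⟩)

theorem hasDerivWithinAt_fst {E F : Type*} [NormedAddCommGroup E] [NormedSpace ℝ E]
    [NormedAddCommGroup F] [NormedSpace ℝ F] {γ : ℝ → E × F} {V : E × F} {J : Set ℝ} {t : ℝ}
    (hγ : HasDerivWithinAt γ V J t) : HasDerivWithinAt (fun r => (γ r).1) V.1 J t := by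
  simpa using hγ.hasFDerivWithinAt.fst.hasDerivWithinAt

theorem derivWithin_fst {E F : Type*} [NormedAddCommGroup E] [NormedSpace ℝ E]
    [NormedAddCommGroup F] [NormedSpace ℝ F] {γ : ℝ → E × F} {J : Set ℝ} {t : ℝ}
    (hγ : DifferentiableWithinAt ℝ γ J t) (hJ : UniqueDiffWithinAt ℝ J t) :
    derivWithin (fun r => (γ r).1) J t = (derivWithin γ J t).1 :=
  (hasDerivWithinAt_fst hγ.hasDerivWithinAt).derivWithin hJ

theorem hasDerivWithinAt_snd {E F : Type*} [NormedAddCommGroup E] [NormedSpace ℝ E]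
    [NormedAddCommGroup F] [NormedSpace ℝ F] {γ : ℝ → E × F} {V : E × F} {J : Set ℝ} {t : ℝ}
    (hγ : HasDerivWithinAt γ V J t) : HasDerivWithinAt (fun r => (γ r).2) V.2 J t := by
  simpa using hγ.hasFDerivWithinAt.snd.hasDerivWithinAt

theorem derivWithin_snd {E F : Type*} [NormedAddCommGroup E] [NormedSpace ℝ E]
    [NormedAddCommGroup F] [NormedSpace ℝ F] {γ : ℝ → E × F} {J : Set ℝ} {t : ℝ}
    (hγ : DifferentiableWithinAt ℝ γ J t) (hJ : UniqueDiffWithinAt ℝ J t) :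
    derivWithin (fun r => (γ r).2) J t = (derivWithin γ J t).2 :=
  (hasDerivWithinAt_snd hγ.hasDerivWithinAt).derivWithin hJ

theorem contDiffOn_derivWithin_top {E : Type*} [NormedAddCommGroup E] [NormedSpace ℝ E]
    {γ : ℝ → E} {J : Set ℝ} (hJ : UniqueDiffOn ℝ J) (hγ : ContDiffOn ℝ ∞ γ J) :
    ContDiffOn ℝ ∞ (derivWithin γ J) J :=
  hγ.derivWithin hJ (by simp)

theorem ne_zero_of_mem_PosVec {τ : Fin n → ℝ} (h : τ ∈ PosVec n) (i : Fin n) : τ i ≠ 0 :=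
  (h i).ne'

theorem accelInner_fisherMetric {γ : ℝ → Param p n} {J : Set ℝ} (hJ : UniqueDiffOn ℝ J)
    (hγ : ContDiffOn ℝ ∞ γ J) {t : ℝ} (ht : t ∈ J) (hM : γ t ∈ paramManifold p n)
    (w : Param p n) :
    accelInner fisherMetric γ J t w =
      (1 / (p : ℝ)) * accelInner metricHPD (fun r => (γ r).1) J t w.1 +
        (1 / (n : ℝ)) * accelInner metricPosVec (fun r => (γ r).2) J t w.2 := by
  have hd : DifferentiableOn ℝ γ J := hγ.differentiableOn (by simp)
  have hd2 := (contDiffOn_derivWithin_top hJ hγ).differentiableOn (by simp)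
  -- The component derivatives agree only on `J`, which suffices for the second derivative within
  -- `J`.
  have e1 : EqOn (derivWithin (fun r => (γ r).1) J) (fun r => (derivWithin γ J r).1) J :=
    fun r hr => derivWithin_fst (hd r hr) (hJ r hr)
  have e2 : EqOn (derivWithin (fun r => (γ r).2) J) (fun r => (derivWithin γ J r).2) J :=
    fun r hr => derivWithin_snd (hd r hr) (hJ r hr)
  rw [accelInner, accelInner, accelInner,
    christoffel_fisherMetric hM.1.1.isUnit (ne_zero_of_mem_PosVec hM.2), fisherMetric,
    derivWithin_congr e1 (e1 ht), derivWithin_congr e2 (e2 ht), e1 ht, e2 ht,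
    derivWithin_fst (hd2 t ht) (hJ t ht), derivWithin_snd (hd2 t ht) (hJ t ht)]
  ring

/-- Geodesics of the product are the pairs of geodesics of the factors. -/
theorem isGeodesicOn_fisherMetric_iff (hp : 0 < p) (hn : 0 < n) {γ : ℝ → Param p n} {J : Set ℝ}
    (hJ : UniqueDiffOn ℝ J) :
    IsGeodesicOn (paramManifold p n) tangentParam fisherMetric γ J ↔
      IsGeodesicOn (SHPD p) tangentSHPD metricHPD (fun t => (γ t).1) J ∧
      IsGeodesicOn (PosVec n) tangentPosVec metricPosVec (fun t => (γ t).2) J := by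
  have hp' : (p : ℝ) ≠ 0 := by positivity
  have hn' : (n : ℝ) ≠ 0 := by positivity
  constructor
  · rintro ⟨hc, hm, ha⟩
    refine ⟨⟨hc.fst, fun t ht => (hm ht).1, fun t ht w hw => ?_⟩,
      ⟨hc.snd, fun t ht => (hm ht).2, fun t ht w _ => ?_⟩⟩
    -- With `0` in the other slot only one factor survives, and its weight is nonzero.
    · have h := ha t ht (w, 0) ⟨hw, mem_univ _⟩
      rw [accelInner_fisherMetric hJ hc ht (hm ht)] at h
      have h0 := accelInner_metricPosVec (γ := fun r => (γ r).2) (J := J)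
        (ne_zero_of_mem_PosVec (hm ht).2) 0
      simp only [metricPosVec, Pi.zero_apply, zero_mul, mul_zero, Finset.sum_const_zero] at h0
      simpa [h0, hp'] using h
    · have h := ha t ht (0, w) ⟨⟨Matrix.isHermitian_zero, by simp⟩, mem_univ _⟩
      rw [accelInner_fisherMetric hJ hc ht (hm ht)] at h
      have h0 := accelInner_metricHPD (γ := fun r => (γ r).1) (J := J) (hm ht).1.1.isUnit 0
      simp only [metricHPD, mul_zero, Matrix.trace_zero, Complex.zero_re] at h0
      simpa [h0, hn'] using h
  · rintro ⟨⟨hc1, hm1, ha1⟩, ⟨hc2, hm2, ha2⟩⟩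
    have hc : ContDiffOn ℝ ∞ γ J := hc1.prodMk hc2
    refine ⟨hc, fun t ht => ⟨hm1 ht, hm2 ht⟩, fun t ht w hw => ?_⟩
    rw [accelInner_fisherMetric hJ hc ht ⟨hm1 ht, hm2 ht⟩, ha1 t ht _ hw.1, ha2 t ht _ hw.2]
    simp

end Calculus

/-! ### Tangency of velocities and the geodesic equations of the two factors -/

section Geodesics

attribute [local instance] frobeniusTopology

variable {p n : ℕ}

theorem differentiable_det : Differentiable ℝ (fun M : Matrix (Fin p) (Fin p) ℂ => M.det) := by
  have he : ∀ i j, Differentiable ℝ (fun M : Matrix (Fin p) (Fin p) ℂ => M i j) := fun i j =>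
    (LinearMap.toContinuousLinearMap (Matrix.entryLinearMap ℝ ℂ i j)).differentiable
  simp only [Matrix.det_apply']
  refine Differentiable.fun_sum fun σ _ => Differentiable.const_mul ?_ _
  exact fun M =>
    (HasFDerivAt.finsetProd fun i _ => (he (σ i) i M).hasFDerivAt).differentiableAt

theorem hasDerivAt_det_one_add_smul (M : Matrix (Fin p) (Fin p) ℂ) :
    HasDerivAt (fun r : ℝ => (1 + r • M).det) M.trace 0 := by
  have h : ∀ r : ℂ, (1 + r • M).det = _ := fun r => Matrix.det_one_add_smul r M
  -- The polynomial `q` is the remainder in `det (1 + r M) = 1 + r tr M + r² q(r)`.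
  set q := (1 + (Polynomial.X : Polynomial ℂ) • M.map Polynomial.C).det.divX.divX
  have h1 : HasDerivAt (fun r : ℂ => (1 + r • M).det) M.trace ((0 : ℝ) : ℂ) := by
    simp only [h, Complex.ofReal_zero]
    have h2 := (((hasDerivAt_id (0 : ℂ)).const_mul M.trace).const_add 1).add
      ((q.hasDerivAt 0).mul (hasDerivAt_pow 2 (0 : ℂ)))
    convert! h2 using 1
    simp
  have h3 := h1.comp_ofReal
  have h4 : ∀ r : ℝ, (r : ℂ) • M = r • M := fun r => by
    ext i j
    simp
  have h5 : (fun r : ℝ => (1 + r • M).det) = fun r : ℝ => (1 + (r : ℂ) • M).det :=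
    funext fun r => by rw [h4]
  exact h5 ▸ h3

/-- Jacobi's formula: factoring out `det (γ t)` moves the base point to `1`, where the differential
of `det` is evaluated along the line `1 + r • (γ t)⁻¹ V`. -/
theorem hasDerivWithinAt_det {γ : ℝ → Matrix (Fin p) (Fin p) ℂ} {V : Matrix (Fin p) (Fin p) ℂ}
    {J : Set ℝ} {t : ℝ} (hγ : HasDerivWithinAt γ V J t) (hu : IsUnit (γ t)) :
    HasDerivWithinAt (fun r => (γ r).det) ((γ t).det * ((γ t)⁻¹ * V).trace) J t := by
  have hu' : IsUnit (γ t).det := (Matrix.isUnit_iff_isUnit_det _).1 hu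
  have h1 : ∀ r, (γ r).det = (γ t).det * ((γ t)⁻¹ * γ r).det := fun r => by
    rw [← Matrix.det_mul, ← mul_assoc, Matrix.mul_nonsing_inv _ hu', one_mul]
  rw [funext h1]
  have h2 : (γ t)⁻¹ * γ t = 1 := Matrix.nonsing_inv_mul _ hu'
  have hd : HasFDerivAt (fun M : Matrix (Fin p) (Fin p) ℂ => M.det) _ (1 : Matrix _ _ ℂ) :=
    (differentiable_det 1).hasFDerivAt
  have hline := hd.comp_hasDerivAt_of_eq (0 : ℝ)
    (((hasDerivAt_id (0 : ℝ)).smul_const ((γ t)⁻¹ * V)).const_add 1) (by simp)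
  have huniq := hline.unique (hasDerivAt_det_one_add_smul ((γ t)⁻¹ * V))
  have h3 := hd.comp_hasDerivWithinAt_of_eq t (hγ.const_mul (γ t)⁻¹) h2.symm
  rw [one_smul] at huniq
  rw [huniq] at h3
  have h4 := h3.const_mul (γ t).det
  convert! h4 using 1

theorem derivWithin_isHermitian {γ : ℝ → Matrix (Fin p) (Fin p) ℂ} {J : Set ℝ} {t : ℝ}
    (hγ : DifferentiableWithinAt ℝ γ J t) (hJ : UniqueDiffWithinAt ℝ J t) (ht : t ∈ J)
    (hH : ∀ r ∈ J, (γ r).IsHermitian) : (derivWithin γ J t).IsHermitian := by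
  have h1 : HasDerivWithinAt (fun r => star (γ r)) (star (derivWithin γ J t)) J t :=
    hγ.hasDerivWithinAt.star
  have h2 : HasDerivWithinAt γ (star (derivWithin γ J t)) J t :=
    h1.congr (fun r hr => (hH r hr).symm) (hH t ht).symm
  exact (h2.derivWithin hJ).symm

theorem trace_derivWithin_eq_zero {γ : ℝ → Matrix (Fin p) (Fin p) ℂ} {J : Set ℝ} {t : ℝ}
    (hγ : DifferentiableWithinAt ℝ γ J t) (hJ : UniqueDiffWithinAt ℝ J t) (ht : t ∈ J)
    (hm : MapsTo γ J (SHPD p)) : ((γ t)⁻¹ * derivWithin γ J t).trace = 0 := by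
  have h1 := hasDerivWithinAt_det hγ.hasDerivWithinAt (hm ht).1.isUnit
  have h2 : HasDerivWithinAt (fun r => (γ r).det) 0 J t :=
    (hasDerivWithinAt_const t J (1 : ℂ)).congr (fun r hr => (hm hr).2) (hm ht).2
  have h3 := (h1.derivWithin hJ).symm.trans (h2.derivWithin hJ)
  rwa [(hm ht).2, one_mul] at h3

theorem derivWithin_mem_tangentSHPD {γ : ℝ → Matrix (Fin p) (Fin p) ℂ} {J : Set ℝ} {t : ℝ}
    (hγ : DifferentiableWithinAt ℝ γ J t) (hJ : UniqueDiffWithinAt ℝ J t) (ht : t ∈ J)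
    (hm : MapsTo γ J (SHPD p)) : derivWithin γ J t ∈ tangentSHPD (γ t) :=
  ⟨derivWithin_isHermitian hγ hJ ht fun _ hr => (hm hr).1.isHermitian,
    trace_derivWithin_eq_zero hγ hJ ht hm⟩

theorem inv_mul_cancel_of_posDef {A : Matrix (Fin p) (Fin p) ℂ} (hA : A.PosDef) : A⁻¹ * A = 1 :=
  Matrix.nonsing_inv_mul _ ((Matrix.isUnit_iff_isUnit_det _).1 hA.isUnit)

theorem mul_inv_cancel_of_posDef {A : Matrix (Fin p) (Fin p) ℂ} (hA : A.PosDef) : A * A⁻¹ = 1 :=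
  Matrix.mul_nonsing_inv _ ((Matrix.isUnit_iff_isUnit_det _).1 hA.isUnit)

/-- The geodesic equation of `SHPD p`: the normal component of the acceleration vanishes too. -/
theorem geodesic_equation_SHPD {γ : ℝ → Matrix (Fin p) (Fin p) ℂ} {J : Set ℝ}
    (hJ : UniqueDiffOn ℝ J) (hγ : IsGeodesicOn (SHPD p) tangentSHPD metricHPD γ J) {t : ℝ}
    (ht : t ∈ J) : derivWithin (derivWithin γ J) J t =
      derivWithin γ J t * (γ t)⁻¹ * derivWithin γ J t := by
  obtain ⟨hc, hm, ha⟩ := hγ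
  have hd : DifferentiableOn ℝ γ J := hc.differentiableOn (by simp)
  have hd2 : DifferentiableOn ℝ (derivWithin γ J) J :=
    (contDiffOn_derivWithin_top hJ hc).differentiableOn (by simp)
  have hT : ∀ r ∈ J, derivWithin γ J r ∈ tangentSHPD (γ r) := fun r hr =>
    derivWithin_mem_tangentSHPD (hd r hr) (hJ r hr) hr hm
  have hH2 : (derivWithin (derivWithin γ J) J t).IsHermitian :=
    derivWithin_isHermitian (hd2 t ht) (hJ t ht) ht fun r hr => (hT r hr).1
  have hHc : (derivWithin γ J t * (γ t)⁻¹ * derivWithin γ J t).IsHermitian :=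
    isHermitian_conj (hT t ht).1 (hm ht).1.isHermitian.inv
  set Z := derivWithin (derivWithin γ J) J t - derivWithin γ J t * (γ t)⁻¹ * derivWithin γ J t
    with hZ
  have hZH : Z.IsHermitian := hH2.sub hHc
  -- This is the derivative of the tangency relation `tr (γ⁻¹ γ') = 0`.
  have hZre : ((γ t)⁻¹ * Z).trace.re = 0 := by
    have h1 := hasDerivWithinAt_reTrace
      ((hasDerivWithinAt_matrix_inv (hd t ht).hasDerivWithinAt (hm ht).1.isUnit).mul
        (hd2 t ht).hasDerivWithinAt)
    have h2 : HasDerivWithinAt (fun r => ((γ r)⁻¹ * derivWithin γ J r).trace.re) 0 J t :=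
      (hasDerivWithinAt_const t J (0 : ℝ)).congr (fun r hr => by simp [(hT r hr).2])
        (by simp [(hT t ht).2])
    have h3 := (h1.derivWithin (hJ t ht)).symm.trans (h2.derivWithin (hJ t ht))
    rw [← h3, hZ]
    congr 2
    noncomm_ring
  have hZim : ((γ t)⁻¹ * Z).trace.im = 0 := by
    have h1 : star ((γ t)⁻¹ * Z).trace = ((γ t)⁻¹ * Z).trace := by
      rw [← Matrix.trace_conjTranspose, Matrix.conjTranspose_mul, hZH.eq,
        (hm ht).1.isHermitian.inv.eq, Matrix.trace_mul_comm]
    exact Complex.conj_eq_iff_im.1 h1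
  -- The acceleration `Z` is tangent, so it may be tested against itself.
  have h := ha t ht Z ⟨hZH, Complex.ext hZre hZim⟩
  rw [accelInner_metricHPD (hm ht).1.isUnit] at h
  exact sub_eq_zero.1 (eq_zero_of_metricHPD_self (hm ht).1 hZH h)

theorem derivWithin_pi_apply {γ : ℝ → Fin n → ℝ} {J : Set ℝ} {t : ℝ}
    (hγ : DifferentiableWithinAt ℝ γ J t) (i : Fin n) :
    HasDerivWithinAt (fun r => γ r i) (derivWithin γ J t i) J t :=
  (hasDerivWithinAt_pi.1 hγ.hasDerivWithinAt) i

theorem geodesic_equation_PosVec {γ : ℝ → Fin n → ℝ} {J : Set ℝ}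
    (hγ : IsGeodesicOn (PosVec n) tangentPosVec metricPosVec γ J) {t : ℝ}
    (ht : t ∈ J) (i : Fin n) : derivWithin (derivWithin γ J) J t i =
      derivWithin γ J t i ^ 2 * (γ t i)⁻¹ := by
  have hx := ne_zero_of_mem_PosVec (hγ.2.1 ht)
  -- All vectors are tangent; testing the acceleration against itself yields a vanishing sum of
  -- squares.
  have h := hγ.2.2 t ht (fun i => derivWithin (derivWithin γ J) J t i -
    derivWithin γ J t i ^ 2 * (γ t i)⁻¹) (mem_univ _)
  rw [accelInner_metricPosVec hx, metricPosVec,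
    Finset.sum_eq_zero_iff_of_nonneg fun i _ => mul_self_nonneg _] at h
  have hi := mul_self_eq_zero.1 (h i (Finset.mem_univ i))
  exact sub_eq_zero.1 ((mul_eq_zero.1 hi).resolve_right (inv_ne_zero (hx i)))

theorem eq_of_hasDerivWithinAt_zero {E : Type*} [NormedAddCommGroup E] [NormedSpace ℝ E]
    {f : ℝ → E} {J : Set ℝ} (hJ : Convex ℝ J) (hf : ∀ t ∈ J, HasDerivWithinAt f 0 J t) {s t : ℝ}
    (hs : s ∈ J) (ht : t ∈ J) : f t = f s := by
  have h := hJ.norm_image_sub_le_of_norm_hasDerivWithin_le (C := 0) hf (by simp) hs ht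
  rw [zero_mul] at h
  exact sub_eq_zero.1 (norm_le_zero_iff.1 h)

theorem hasDerivAt_exp_smul_matrix (C : Matrix (Fin p) (Fin p) ℂ) (t : ℝ) :
    HasDerivAt (fun r : ℝ => NormedSpace.exp (r • C)) (NormedSpace.exp (t • C) * C) t :=
  have : CompleteSpace (Matrix (Fin p) (Fin p) ℂ) := FiniteDimensional.complete ℝ _
  hasDerivAt_exp_smul_const (𝕂 := ℝ) C t

theorem hasDerivAt_exp_smul_matrix' (C : Matrix (Fin p) (Fin p) ℂ) (t : ℝ) :
    HasDerivAt (fun r : ℝ => NormedSpace.exp (r • C)) (C * NormedSpace.exp (t • C)) t :=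
  have : CompleteSpace (Matrix (Fin p) (Fin p) ℂ) := FiniteDimensional.complete ℝ _
  hasDerivAt_exp_smul_const' (𝕂 := ℝ) C t

theorem contDiff_exp_smul_matrix (C : Matrix (Fin p) (Fin p) ℂ) :
    ContDiff ℝ ∞ (fun r : ℝ => NormedSpace.exp (r • C)) := by
  have : CompleteSpace (Matrix (Fin p) (Fin p) ℂ) := FiniteDimensional.complete ℝ _
  have h : ContDiff ℝ ∞ (NormedSpace.exp : Matrix (Fin p) (Fin p) ℂ → Matrix (Fin p) (Fin p) ℂ) :=
    contDiff_iff_contDiffAt.2 fun x => (NormedSpace.exp_analytic (𝕂 := ℝ) x).contDiffAt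
  exact h.comp (contDiff_id.smul contDiff_const)

theorem exp_neg_smul_mul_exp_smul (C : Matrix (Fin p) (Fin p) ℂ) (t : ℝ) :
    NormedSpace.exp ((-t) • C) * NormedSpace.exp (t • C) = 1 := by
  have : CompleteSpace (Matrix (Fin p) (Fin p) ℂ) := FiniteDimensional.complete ℝ _
  have : Algebra ℚ (Matrix (Fin p) (Fin p) ℂ) := Algebra.restrictScalars ℚ ℝ _
  rw [← NormedSpace.exp_add_of_commute (((Commute.refl C).smul_left _).smul_right _), ← add_smul,
    neg_add_cancel, zero_smul, NormedSpace.exp_zero]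

/-- The geodesic equation is `(γ⁻¹ γ')' = 0`. With `γ' = γ C` and `C` constant, `γ exp (-t C)` has
derivative zero as well. -/
theorem geodesic_SHPD_eq_exp {γ : ℝ → Matrix (Fin p) (Fin p) ℂ} {J : Set ℝ} (hJc : Convex ℝ J)
    (hJ : UniqueDiffOn ℝ J) (h0 : 0 ∈ J)
    (hγ : IsGeodesicOn (SHPD p) tangentSHPD metricHPD γ J) {t : ℝ} (ht : t ∈ J) :
    γ t = γ 0 * NormedSpace.exp (t • ((γ 0)⁻¹ * derivWithin γ J 0)) := by
  obtain ⟨hc, hm, -⟩ := id hγ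
  have hd : DifferentiableOn ℝ γ J := hc.differentiableOn (by simp)
  have hd2 : DifferentiableOn ℝ (derivWithin γ J) J :=
    (contDiffOn_derivWithin_top hJ hc).differentiableOn (by simp)
  set C := (γ 0)⁻¹ * derivWithin γ J 0 with hC
  have hconst : ∀ r ∈ J, (γ r)⁻¹ * derivWithin γ J r = C := fun r hr => by
    refine eq_of_hasDerivWithinAt_zero (f := fun r => (γ r)⁻¹ * derivWithin γ J r) hJc
      (fun s hs => ?_) h0 hr
    have h1 := (hasDerivWithinAt_matrix_inv (hd s hs).hasDerivWithinAt (hm hs).1.isUnit).mul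
        (hd2 s hs).hasDerivWithinAt
    rw [geodesic_equation_SHPD hJ hγ hs] at h1
    convert! h1 using 1
    noncomm_ring
  have hder : ∀ r ∈ J, derivWithin γ J r = γ r * C := fun r hr => by
    rw [← hconst r hr, ← mul_assoc, mul_inv_cancel_of_posDef (hm hr).1, one_mul]
  have h2 := eq_of_hasDerivWithinAt_zero (f := fun r => γ r * NormedSpace.exp (r • (-C))) hJc
    (fun s hs => by
      have h1 := (hd s hs).hasDerivWithinAt.mul
        (hasDerivAt_exp_smul_matrix' (-C) s).hasDerivWithinAt
      rw [hder s hs] at h1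
      convert! h1 using 1
      noncomm_ring) h0 ht
  simp only [zero_smul, NormedSpace.exp_zero, mul_one] at h2
  rw [← h2, smul_neg, ← neg_smul, mul_assoc, exp_neg_smul_mul_exp_smul, mul_one]

theorem geodesic_PosVec_eq_exp {γ : ℝ → Fin n → ℝ} {J : Set ℝ} (hJc : Convex ℝ J)
    (hJ : UniqueDiffOn ℝ J) (h0 : 0 ∈ J)
    (hγ : IsGeodesicOn (PosVec n) tangentPosVec metricPosVec γ J) {t : ℝ} (ht : t ∈ J)
    (i : Fin n) :
    γ t i = γ 0 i * Real.exp (t * ((γ 0 i)⁻¹ * derivWithin γ J 0 i)) := by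
  obtain ⟨hc, hm, -⟩ := id hγ
  have hd : DifferentiableOn ℝ γ J := hc.differentiableOn (by simp)
  have hd2 : DifferentiableOn ℝ (derivWithin γ J) J :=
    (contDiffOn_derivWithin_top hJ hc).differentiableOn (by simp)
  set C := (γ 0 i)⁻¹ * derivWithin γ J 0 i with hC
  have hconst : ∀ r ∈ J, (γ r i)⁻¹ * derivWithin γ J r i = C := fun r hr => by
    refine eq_of_hasDerivWithinAt_zero (f := fun r => (γ r i)⁻¹ * derivWithin γ J r i) hJc
      (fun s hs => ?_) h0 hr
    have hne := ne_zero_of_mem_PosVec (hm hs) i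
    have h1 := ((derivWithin_pi_apply (hd s hs) i).inv hne).mul
      (derivWithin_pi_apply (hd2 s hs) i)
    rw [geodesic_equation_PosVec hγ hs] at h1
    convert! h1 using 1
    simp only [Pi.inv_apply]
    field_simp
    ring
  have hder : ∀ r ∈ J, derivWithin γ J r i = γ r i * C := fun r hr => by
    rw [← hconst r hr, ← mul_assoc, mul_inv_cancel₀ (ne_zero_of_mem_PosVec (hm hr) i), one_mul]
  have h2 := eq_of_hasDerivWithinAt_zero (f := fun r => γ r i * Real.exp (-(r * C))) hJc
    (fun s hs => by
      have h1 := (derivWithin_pi_apply (hd s hs) i).mul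
        (((hasDerivAt_id s).mul_const C).fun_neg.exp).hasDerivWithinAt
      rw [hder s hs] at h1
      convert! h1 using 1
      simp only [id]
      ring) h0 ht
  simp only [zero_mul, neg_zero, Real.exp_zero, mul_one] at h2
  rw [← h2, mul_assoc, ← Real.exp_add, neg_add_cancel, Real.exp_zero, mul_one]

end Geodesics

/-! ### Exponential curves, the Riemannian logarithm and uniqueness -/

section ExplicitGeodesics

variable {p n : ℕ}

/-- The matrix `A⁻¹ ξ` is conjugate by `A^(-1/2)` to `whiten A ξ`, and `exp` respects conjugation.
For Hermitian `ξ` the left side is visibly positive definite. -/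
theorem half_conj_exp_whiten {A : Matrix (Fin p) (Fin p) ℂ} (hA : A.PosDef)
    (ξ : Matrix (Fin p) (Fin p) ℂ) (t : ℝ) :
    hpow A (1 / 2) * NormedSpace.exp (t • whiten A ξ) * hpow A (1 / 2) =
      A * NormedSpace.exp (t • (A⁻¹ * ξ)) := by
  have hinv : (hpow A (-(1 / 2)))⁻¹ = hpow A (1 / 2) :=
    Matrix.inv_eq_left_inv (half_mul_neg_half hA)
  have h1 : t • (A⁻¹ * ξ) =
      hpow A (-(1 / 2)) * (t • whiten A ξ) * (hpow A (-(1 / 2)))⁻¹ := by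
    rw [hinv, whiten, mul_smul_comm, smul_mul_assoc]
    congr 1
    rw [mul_assoc, mul_assoc, mul_assoc, neg_half_mul_half hA, mul_one, ← mul_assoc,
      neg_half_mul_neg_half hA]
  rw [h1, Matrix.exp_conj _ _ (isUnit_hpow hA _), hinv]
  simp only [← mul_assoc]
  congr 2
  nth_rw 2 [← half_mul_half hA]
  rw [mul_assoc, half_mul_neg_half hA, mul_one]

theorem isHermitian_whiten {A B : Matrix (Fin p) (Fin p) ℂ} (hB : B.IsHermitian) :
    (whiten A B).IsHermitian :=
  isHermitian_conj (isHermitian_hpow _ _) hB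

theorem mul_exp_mem_SHPD {A ξ : Matrix (Fin p) (Fin p) ℂ} (hA : A ∈ SHPD p)
    (hξ : ξ ∈ tangentSHPD A) (t : ℝ) : A * NormedSpace.exp (t • (A⁻¹ * ξ)) ∈ SHPD p := by
  have hH := isHermitian_smul_real t (isHermitian_whiten (A := A) hξ.1)
  have hdet : (hpow A (1 / 2)).det * (hpow A (1 / 2)).det = 1 := by
    rw [← Matrix.det_mul, half_mul_half hA.1, hA.2]
  rw [← half_conj_exp_whiten hA.1]
  refine ⟨posDef_conj_of_isUnit (isHermitian_hpow _ _) (isUnit_hpow hA.1 _) (posDef_exp hH), ?_⟩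
  rw [Matrix.det_mul, Matrix.det_mul, det_exp_of_isHermitian hH, Matrix.trace_smul,
    trace_whiten hA.1, hξ.2, smul_zero, Complex.exp_zero, mul_one, hdet]

theorem expCurve_zero (θ ξ : Param p n) : expCurve θ ξ 0 = θ := by
  simp [expCurve]

theorem expCurve_mem {θ ξ : Param p n} (hθ : θ ∈ paramManifold p n) (hξ : ξ ∈ tangentParam θ)
    (t : ℝ) : expCurve θ ξ t ∈ paramManifold p n :=
  ⟨mul_exp_mem_SHPD hθ.1 hξ.1 t, fun i => mul_pos (hθ.2 i) (Real.exp_pos _)⟩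

section Derivatives

attribute [local instance] frobeniusTopology

theorem hasDerivAt_expCurve_fst (θ ξ : Param p n) (t : ℝ) :
    HasDerivAt (fun r => (expCurve θ ξ r).1) ((expCurve θ ξ t).1 * (θ.1⁻¹ * ξ.1)) t := by
  have h := (hasDerivAt_exp_smul_matrix (θ.1⁻¹ * ξ.1) t).const_mul θ.1
  rw [← mul_assoc] at h
  exact h

theorem hasDerivAt_expCurve_snd (θ ξ : Param p n) (t : ℝ) :
    HasDerivAt (fun r => (expCurve θ ξ r).2)
      (fun i => (expCurve θ ξ t).2 i * ((θ.2 i)⁻¹ * ξ.2 i)) t := by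
  refine hasDerivAt_pi.2 fun i => ?_
  have h := ((hasDerivAt_id t).mul_const ((θ.2 i)⁻¹ * ξ.2 i)).exp.const_mul (θ.2 i)
  convert! h using 1
  simp only [expCurve, id]
  ring

theorem contDiff_expCurve (θ ξ : Param p n) : ContDiff ℝ ∞ (expCurve θ ξ) := by
  have h1 : ContDiff ℝ ∞ (fun t => (expCurve θ ξ t).1) :=
    contDiff_const.mul (contDiff_exp_smul_matrix (θ.1⁻¹ * ξ.1))
  have h2 : ContDiff ℝ ∞ (fun t => (expCurve θ ξ t).2) :=
    contDiff_pi.2 fun i => contDiff_const.mul (contDiff_id.mul contDiff_const).exp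
  exact h1.prodMk h2

theorem hasDerivAt_expCurve (θ ξ : Param p n) (t : ℝ) :
    HasDerivAt (expCurve θ ξ) ((expCurve θ ξ t).1 * (θ.1⁻¹ * ξ.1),
      fun i => (expCurve θ ξ t).2 i * ((θ.2 i)⁻¹ * ξ.2 i)) t :=
  (hasDerivAt_expCurve_fst θ ξ t).prodMk (hasDerivAt_expCurve_snd θ ξ t)

theorem hasDerivAt_expCurve_zero {θ : Param p n} (hθ : θ ∈ paramManifold p n) (ξ : Param p n) :
    HasDerivAt (expCurve θ ξ) ξ 0 := by
  convert! hasDerivAt_expCurve θ ξ 0 using 1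
  rw [expCurve_zero]
  refine Prod.ext ?_ (funext fun i => ?_)
  · simp only
    rw [← mul_assoc, mul_inv_cancel_of_posDef hθ.1.1, one_mul]
  · simp only
    rw [← mul_assoc, mul_inv_cancel₀ (ne_zero_of_mem_PosVec hθ.2 i), one_mul]

/-- Since `γ' = γ C`, both `γ''` and `γ' γ⁻¹ γ'` equal `γ C²`. -/
theorem isGeodesicOn_expCurve_fst {θ ξ : Param p n} (hθ : θ ∈ paramManifold p n)
    (hξ : ξ ∈ tangentParam θ) :
    IsGeodesicOn (SHPD p) tangentSHPD metricHPD (fun t => (expCurve θ ξ t).1) univ := by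
  refine ⟨(contDiff_expCurve θ ξ).fst.contDiffOn, fun t _ => (expCurve_mem hθ hξ t).1,
    fun t _ w _ => ?_⟩
  have hpd := (expCurve_mem hθ hξ t).1.1
  have h1 : derivWithin (fun r => (expCurve θ ξ r).1) univ =
      fun r => (expCurve θ ξ r).1 * (θ.1⁻¹ * ξ.1) := by
    rw [derivWithin_univ]
    exact funext fun r => (hasDerivAt_expCurve_fst θ ξ r).deriv
  have h2 : derivWithin (fun r => (expCurve θ ξ r).1 * (θ.1⁻¹ * ξ.1)) univ t =
      (expCurve θ ξ t).1 * (θ.1⁻¹ * ξ.1) * (θ.1⁻¹ * ξ.1) := by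
    rw [derivWithin_univ]
    exact ((hasDerivAt_expCurve_fst θ ξ t).mul_const _).deriv
  rw [accelInner_metricHPD hpd.isUnit, h1, h2]
  have h3 : (expCurve θ ξ t).1 * (θ.1⁻¹ * ξ.1) * ((expCurve θ ξ t).1)⁻¹ *
      ((expCurve θ ξ t).1 * (θ.1⁻¹ * ξ.1)) =
      (expCurve θ ξ t).1 * (θ.1⁻¹ * ξ.1) * (θ.1⁻¹ * ξ.1) := by
    rw [mul_assoc _ ((expCurve θ ξ t).1)⁻¹, ← mul_assoc ((expCurve θ ξ t).1)⁻¹,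
      inv_mul_cancel_of_posDef hpd, one_mul]
  rw [h3, sub_self]
  simp [metricHPD]

theorem isGeodesicOn_expCurve_snd {θ ξ : Param p n} (hθ : θ ∈ paramManifold p n)
    (hξ : ξ ∈ tangentParam θ) :
    IsGeodesicOn (PosVec n) tangentPosVec metricPosVec (fun t => (expCurve θ ξ t).2) univ := by
  refine ⟨(contDiff_expCurve θ ξ).snd.contDiffOn, fun t _ => (expCurve_mem hθ hξ t).2,
    fun t _ w _ => ?_⟩
  have hne := ne_zero_of_mem_PosVec (expCurve_mem hθ hξ t).2
  have h1 : derivWithin (fun r => (expCurve θ ξ r).2) univ =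
      fun r i => (expCurve θ ξ r).2 i * ((θ.2 i)⁻¹ * ξ.2 i) := by
    rw [derivWithin_univ]
    exact funext fun r => (hasDerivAt_expCurve_snd θ ξ r).deriv
  have h2 : derivWithin (fun r i => (expCurve θ ξ r).2 i * ((θ.2 i)⁻¹ * ξ.2 i)) univ t =
      fun i => (expCurve θ ξ t).2 i * ((θ.2 i)⁻¹ * ξ.2 i) * ((θ.2 i)⁻¹ * ξ.2 i) := by
    rw [derivWithin_univ]
    exact (hasDerivAt_pi.2 fun i =>
      ((hasDerivAt_pi.1 (hasDerivAt_expCurve_snd θ ξ t)) i).mul_const _).deriv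
  rw [accelInner_metricPosVec hne, h1, h2, metricPosVec]
  refine Finset.sum_eq_zero fun i _ => ?_
  have := hne i
  field_simp
  ring

theorem isGeodesicOn_expCurve (hp : 0 < p) (hn : 0 < n) {θ ξ : Param p n}
    (hθ : θ ∈ paramManifold p n) (hξ : ξ ∈ tangentParam θ) :
    IsGeodesicOn (paramManifold p n) tangentParam fisherMetric (expCurve θ ξ) univ :=
  (isGeodesicOn_fisherMetric_iff hp hn uniqueDiffOn_univ).2
    ⟨isGeodesicOn_expCurve_fst hθ hξ, isGeodesicOn_expCurve_snd hθ hξ⟩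

theorem geodesic_eq_expCurve (hp : 0 < p) (hn : 0 < n) {γ : ℝ → Param p n} {J : Set ℝ}
    (hJ : J.OrdConnected) (hJn : J.Nontrivial) (h0 : 0 ∈ J)
    (hγ : IsGeodesicOn (paramManifold p n) tangentParam fisherMetric γ J) :
    EqOn γ (expCurve (γ 0) (derivWithin γ J 0)) J := by
  intro t ht
  have hu := uniqueDiffOn_of_ordConnected hJ hJn
  have hd : DifferentiableWithinAt ℝ γ J 0 := hγ.1.differentiableOn (by simp) 0 h0
  obtain ⟨h1, h2⟩ := (isGeodesicOn_fisherMetric_iff hp hn hu).1 hγ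
  have e1 := geodesic_SHPD_eq_exp hJ.convex hu h0 h1 ht
  have e2 := geodesic_PosVec_eq_exp hJ.convex hu h0 h2 ht
  rw [derivWithin_fst hd (hu 0 h0)] at e1
  rw [derivWithin_snd hd (hu 0 h0)] at e2
  exact Prod.ext e1 (funext e2)

theorem derivWithin_mem_tangentParam {γ : ℝ → Param p n} {J : Set ℝ} {t : ℝ}
    (hγ : DifferentiableWithinAt ℝ γ J t) (hJ : UniqueDiffWithinAt ℝ J t) (ht : t ∈ J)
    (hm : MapsTo γ J (paramManifold p n)) : derivWithin γ J t ∈ tangentParam (γ t) := by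
  have h := derivWithin_mem_tangentSHPD (γ := fun r => (γ r).1) hγ.fst hJ ht fun r hr => (hm hr).1
  rw [derivWithin_fst hγ hJ] at h
  exact ⟨h, mem_univ _⟩

end Derivatives

/-- The Riemannian logarithm on the parameter manifold: the initial velocity of `joinCurve`. -/
def logParam (θ₀ θ₁ : Param p n) : Param p n :=
  (hpow θ₀.1 (1 / 2) * hlog (whiten θ₀.1 θ₁.1) * hpow θ₀.1 (1 / 2),
    fun i => θ₀.2 i * Real.log ((θ₀.2 i)⁻¹ * θ₁.2 i))

/-- The trace is the sum of the logarithms of the eigenvalues, that is, `log (det W)`. It makes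
`logParam` tangent to the determinant-one manifold. -/
theorem trace_hlog_eq_zero {W : Matrix (Fin p) (Fin p) ℂ} (hW : W.PosDef) (hdet : W.det = 1) :
    (hlog W).trace = 0 := by
  have h1 : (W.det : ℂ) = ∏ i, (hW.isHermitian.eigenvalues i : ℂ) :=
    hW.isHermitian.det_eq_prod_eigenvalues
  rw [hdet] at h1
  have h2 : ∏ i, hW.isHermitian.eigenvalues i = 1 := by exact_mod_cast h1.symm
  rw [hlog, trace_cfc hW.isHermitian, ← Complex.ofReal_sum,
    ← Real.log_prod fun i _ => (hW.eigenvalues_pos i).ne', h2, Real.log_one, Complex.ofReal_zero]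

theorem logParam_mem {θ₀ θ₁ : Param p n} (h₀ : θ₀ ∈ paramManifold p n)
    (h₁ : θ₁ ∈ paramManifold p n) : logParam θ₀ θ₁ ∈ tangentParam θ₀ := by
  refine ⟨⟨isHermitian_conj (isHermitian_hpow _ _) (isHermitian_hlog _), ?_⟩, mem_univ _⟩
  rw [← trace_whiten h₀.1.1, logParam, whiten_half_conj h₀.1.1]
  exact trace_hlog_eq_zero (posDef_whiten h₀.1.1 h₁.1.1) (det_whiten h₀.1 h₁.1)

theorem joinCurve_eq_expCurve {θ₀ θ₁ : Param p n} (h₀ : θ₀ ∈ paramManifold p n)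
    (h₁ : θ₁ ∈ paramManifold p n) : joinCurve θ₀ θ₁ = expCurve θ₀ (logParam θ₀ θ₁) := by
  funext t
  refine Prod.ext ?_ (funext fun i => ?_)
  · simp only [joinCurve, expCurve]
    rw [← half_conj_exp_whiten h₀.1.1, logParam, whiten_half_conj h₀.1.1,
      hpow_eq_exp (posDef_whiten h₀.1.1 h₁.1.1)]
  · simp only [joinCurve, expCurve, logParam]
    have ha := h₀.2 i
    have hb := h₁.2 i
    rw [inv_mul_cancel_left₀ ha.ne', Real.rpow_sub ha, Real.rpow_one, mul_comm t,
      ← Real.rpow_def_of_pos (by positivity), Real.mul_rpow (by positivity) hb.le,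
      Real.inv_rpow ha.le]
    ring

theorem joinCurve_zero {θ₀ θ₁ : Param p n} (h₀ : θ₀ ∈ paramManifold p n)
    (h₁ : θ₁ ∈ paramManifold p n) : joinCurve θ₀ θ₁ 0 = θ₀ := by
  rw [joinCurve_eq_expCurve h₀ h₁, expCurve_zero]

theorem joinCurve_one {θ₀ θ₁ : Param p n} (h₀ : θ₀ ∈ paramManifold p n)
    (h₁ : θ₁ ∈ paramManifold p n) : joinCurve θ₀ θ₁ 1 = θ₁ := by
  refine Prod.ext ?_ (funext fun i => ?_)
  · simp only [joinCurve]
    rw [hpow_one (posDef_whiten h₀.1.1 h₁.1.1).isHermitian, half_conj_whiten h₀.1.1]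
  · simp [joinCurve]

/-- Injectivity of the Riemannian exponential: after whitening, `hlog` recovers the Hermitian
exponent. Endpoints therefore determine the initial velocity. -/
theorem eq_logParam_of_expCurve_one {θ₀ θ₁ ξ : Param p n} (h₀ : θ₀ ∈ paramManifold p n)
    (hξ : ξ ∈ tangentParam θ₀) (h : expCurve θ₀ ξ 1 = θ₁) : ξ = logParam θ₀ θ₁ := by
  subst h
  refine Prod.ext ?_ (funext fun i => ?_)
  · simp only [logParam, expCurve]
    rw [← half_conj_exp_whiten h₀.1.1, whiten_half_conj h₀.1.1, one_smul,
      hlog_exp (isHermitian_whiten hξ.1.1), half_conj_whiten h₀.1.1]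
  · simp only [logParam, expCurve]
    have ha := ne_zero_of_mem_PosVec h₀.2 i
    rw [inv_mul_cancel_left₀ ha, Real.log_exp, one_mul, mul_inv_cancel_left₀ ha]

theorem geodesic_eq_joinCurve (hp : 0 < p) (hn : 0 < n) {γ : ℝ → Param p n} {J : Set ℝ}
    (hJ : J.OrdConnected) (h0 : 0 ∈ J) (h1 : 1 ∈ J)
    (hγ : IsGeodesicOn (paramManifold p n) tangentParam fisherMetric γ J) :
    EqOn γ (joinCurve (γ 0) (γ 1)) J := by
  have hJn : J.Nontrivial := ⟨0, h0, 1, h1, zero_ne_one⟩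
  have hu := uniqueDiffOn_of_ordConnected hJ hJn
  have hd : DifferentiableWithinAt ℝ γ J 0 := hγ.1.differentiableOn (by simp) 0 h0
  have he := geodesic_eq_expCurve hp hn hJ hJn h0 hγ
  have hl := eq_logParam_of_expCurve_one (hγ.2.1 h0)
    (derivWithin_mem_tangentParam hd (hu 0 h0) h0 hγ.2.1) (he h1).symm
  rw [joinCurve_eq_expCurve (hγ.2.1 h0) (hγ.2.1 h1), ← hl]
  exact he

end ExplicitGeodesics

/-! ### Differentiating the squared norm of the logarithm; length estimates -/

section Distance

variable {p n : ℕ}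

theorem sq_log_le {s : ℝ} (hs : 0 < s) : Real.log s ^ 2 ≤ (s - 1) ^ 2 + (1 - s⁻¹) ^ 2 := by
  have h1 := Real.log_le_sub_one_of_pos hs
  have h2 := Real.one_sub_inv_le_log_of_pos hs
  rcases le_total 0 (Real.log s) with h | h
  · nlinarith [sq_nonneg (1 - s⁻¹)]
  · nlinarith [sq_nonneg (s - 1)]

/-- From `1 - s⁻¹ ≤ log s ≤ s - 1`, the error is at most `(s - 1) - (1 - s⁻¹)`, which equals the
product `(s - 1) (1 - s⁻¹)`; then AM–GM applies. -/
theorem abs_log_sub_le {s : ℝ} (hs : 0 < s) :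
    |Real.log s - (s - 1)| ≤ ((s - 1) ^ 2 + (1 - s⁻¹) ^ 2) / 2 := by
  have h1 := Real.log_le_sub_one_of_pos hs
  have h2 := Real.one_sub_inv_le_log_of_pos hs
  have h3 : (s - 1) * (1 - s⁻¹) = (s - 1) - (1 - s⁻¹) := by
    field_simp
  rw [abs_le]
  constructor <;> nlinarith [sq_nonneg ((s - 1) - (1 - s⁻¹)), sq_nonneg (s - 1),
    sq_nonneg (1 - s⁻¹)]

/-- A global second-order Taylor estimate for `log ^ 2`. -/
theorem abs_sq_log_taylor_le {a b : ℝ} (ha : 0 < a) (hb : 0 < b) :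
    |Real.log b ^ 2 - Real.log a ^ 2 - 2 * (Real.log a * a⁻¹ * (b - a))| ≤
      ((|Real.log a| + 1) * (a⁻¹ ^ 2 + a ^ 2)) * ((b - a) ^ 2 + (b⁻¹ - a⁻¹) ^ 2) := by
  -- Passing to the ratio reduces the estimate to an expansion of `log` at `1`.
  obtain ⟨s, hs, rfl⟩ : ∃ s, 0 < s ∧ b = a * s :=
    ⟨b / a, by positivity, by field_simp⟩
  have e1 : Real.log (a * s) ^ 2 - Real.log a ^ 2 - 2 * (Real.log a * a⁻¹ * (a * s - a)) =
      2 * (Real.log a * (Real.log s - (s - 1))) + Real.log s ^ 2 := by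
    rw [Real.log_mul ha.ne' hs.ne']
    field_simp
    ring
  have e2 : (s - 1) ^ 2 = a⁻¹ ^ 2 * (a * s - a) ^ 2 := by field_simp
  have e3 : (1 - s⁻¹) ^ 2 = a ^ 2 * ((a * s)⁻¹ - a⁻¹) ^ 2 := by
    field_simp
    ring
  have h4 : (s - 1) ^ 2 + (1 - s⁻¹) ^ 2 ≤
      (a⁻¹ ^ 2 + a ^ 2) * ((a * s - a) ^ 2 + ((a * s)⁻¹ - a⁻¹) ^ 2) := by
    rw [e2, e3]
    have t1 : 0 ≤ a⁻¹ ^ 2 * ((a * s)⁻¹ - a⁻¹) ^ 2 := by positivity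
    have t2 : 0 ≤ a ^ 2 * (a * s - a) ^ 2 := by positivity
    linarith
  rw [e1]
  have h5 : |2 * (Real.log a * (Real.log s - (s - 1)))| ≤
      |Real.log a| * ((s - 1) ^ 2 + (1 - s⁻¹) ^ 2) := by
    rw [abs_mul, abs_mul, abs_two]
    have := mul_le_mul_of_nonneg_left (abs_log_sub_le hs) (abs_nonneg (Real.log a))
    linarith
  have h6 : |Real.log s ^ 2| ≤ (s - 1) ^ 2 + (1 - s⁻¹) ^ 2 := by
    rw [abs_of_nonneg (sq_nonneg _)]
    exact sq_log_le hs
  calc |2 * (Real.log a * (Real.log s - (s - 1))) + Real.log s ^ 2|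
      ≤ (|Real.log a| + 1) * ((s - 1) ^ 2 + (1 - s⁻¹) ^ 2) := by
        have := abs_add_le (2 * (Real.log a * (Real.log s - (s - 1)))) (Real.log s ^ 2)
        linarith
    _ ≤ _ := by
        rw [mul_assoc]
        exact mul_le_mul_of_nonneg_left h4 (by positivity)

theorem cfc_inv_of_posDef {A : Matrix (Fin p) (Fin p) ℂ} (hA : A.PosDef) :
    cfc (fun x : ℝ => x⁻¹) A = A⁻¹ := by
  rw [← neg_half_mul_neg_half hA, hpow_mul_hpow hA, hpow]
  refine cfc_congr fun x _ => ?_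
  norm_num [Real.rpow_neg_one]

/-- The matrix version of `abs_sq_log_taylor_le`: the squared Frobenius norm of the logarithm
is differentiable with quadratic error. -/
theorem abs_norm_hlog_sq_taylor_le {A : Matrix (Fin p) (Fin p) ℂ} (hA : A.PosDef) :
    ∃ C : ℝ, ∀ B : Matrix (Fin p) (Fin p) ℂ, B.PosDef →
      |‖hlog B‖ ^ 2 - ‖hlog A‖ ^ 2 - 2 * (hlog A * A⁻¹ * (B - A)).trace.re| ≤
        C * (((B - A) * (B - A)).trace.re + ((B⁻¹ - A⁻¹) * (B⁻¹ - A⁻¹)).trace.re) := by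
  have hAh := hA.isHermitian
  -- These are the scalar constants at the eigenvalues of `A`; their sum serves all of them and does
  -- not depend on `B`.
  set c : Fin p → ℝ := fun i => (|Real.log (hAh.eigenvalues i)| + 1) *
    ((hAh.eigenvalues i)⁻¹ ^ 2 + hAh.eigenvalues i ^ 2)
  have hc : ∀ i, 0 ≤ c i := fun i => by positivity
  refine ⟨∑ i, c i, fun B hB => ?_⟩
  have hBh := hB.isHermitian
  obtain ⟨w, hw, htr⟩ := exists_trace_cfc_mul_cfc hAh hBh
  have one_cfc : ∀ {M : Matrix (Fin p) (Fin p) ℂ}, M.IsHermitian →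
      cfc (fun _ : ℝ => (1 : ℝ)) M = 1 := fun hM => cfc_const_one ℝ _ hM
  have id_cfc : ∀ {M : Matrix (Fin p) (Fin p) ℂ}, M.IsHermitian →
      cfc (fun x : ℝ => x) M = M := fun hM => cfc_id' ℝ _ hM
  -- The identity matrix is inserted as the constant function `1` of the other matrix, so that all
  -- terms become double sums with the same weights and compare termwise.
  have t1 : ‖hlog B‖ ^ 2 = ∑ i, ∑ j, w i j * (1 * Real.log (hBh.eigenvalues j) ^ 2) := by
    rw [← htr (fun _ => 1) (fun x => Real.log x ^ 2), one_cfc hAh, one_mul,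
      ← trace_mul_self_of_isHermitian (isHermitian_hlog B), hlog, cfc_mul_of_matrix]
    simp only [sq]
  have t2 : ‖hlog A‖ ^ 2 = ∑ i, ∑ j, w i j * (Real.log (hAh.eigenvalues i) ^ 2 * 1) := by
    rw [← htr (fun x => Real.log x ^ 2) (fun _ => 1), one_cfc hBh, mul_one,
      ← trace_mul_self_of_isHermitian (isHermitian_hlog A), hlog, cfc_mul_of_matrix]
    simp only [sq]
  have t3 : (hlog A * A⁻¹ * (B - A)).trace.re = ∑ i, ∑ j, w i j *
      (Real.log (hAh.eigenvalues i) * (hAh.eigenvalues i)⁻¹ * hBh.eigenvalues j) -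
      ∑ i, ∑ j, w i j *
      (Real.log (hAh.eigenvalues i) * (hAh.eigenvalues i)⁻¹ * hAh.eigenvalues i * 1) := by
    rw [← htr (fun x => Real.log x * x⁻¹) (fun x => x),
      ← htr (fun x => Real.log x * x⁻¹ * x) (fun _ => 1), one_cfc hBh, mul_one, id_cfc hBh,
      ← cfc_mul_of_matrix (fun x => Real.log x * x⁻¹) (fun x => x), id_cfc hAh,
      ← cfc_mul_of_matrix, cfc_inv_of_posDef hA, mul_sub, Matrix.trace_sub, Complex.sub_re, hlog]
  have sq_trace : ∀ f : ℝ → ℝ, ((cfc f B - cfc f A) * (cfc f B - cfc f A)).trace.re =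
      ∑ i, ∑ j, w i j * (1 * f (hBh.eigenvalues j) ^ 2) -
        2 * ∑ i, ∑ j, w i j * (f (hAh.eigenvalues i) * f (hBh.eigenvalues j)) +
        ∑ i, ∑ j, w i j * (f (hAh.eigenvalues i) ^ 2 * 1) := fun f => by
    rw [← htr (fun _ => 1) (fun x => f x ^ 2), ← htr f f, ← htr (fun x => f x ^ 2) (fun _ => 1),
      one_cfc hAh, one_cfc hBh, one_mul, mul_one]
    simp only [sq, ← cfc_mul_of_matrix]
    rw [sub_mul, mul_sub, mul_sub]
    simp only [Matrix.trace_sub, Complex.sub_re]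
    rw [Matrix.trace_mul_comm (cfc f B) (cfc f A)]
    ring
  have t4 := sq_trace (fun x => x)
  have t5 := sq_trace (fun x => x⁻¹)
  rw [id_cfc hAh, id_cfc hBh] at t4
  rw [cfc_inv_of_posDef hA, cfc_inv_of_posDef hB] at t5
  rw [t1, t2, t3, t4, t5]
  simp only [← Finset.sum_sub_distrib, ← Finset.sum_add_distrib, Finset.mul_sum]
  refine (Finset.abs_sum_le_sum_abs _ _).trans (Finset.sum_le_sum fun i _ => ?_)
  refine (Finset.abs_sum_le_sum_abs _ _).trans (Finset.sum_le_sum fun j _ => ?_)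
  have ha := hA.eigenvalues_pos i
  have hb := hB.eigenvalues_pos j
  have hs := abs_sq_log_taylor_le ha hb
  have hci : c i ≤ ∑ i, c i := Finset.single_le_sum (fun i _ => hc i) (Finset.mem_univ i)
  have hlin : c i * ((hBh.eigenvalues j - hAh.eigenvalues i) ^ 2 +
      ((hBh.eigenvalues j)⁻¹ - (hAh.eigenvalues i)⁻¹) ^ 2) ≤
      (∑ i, c i) * ((hBh.eigenvalues j - hAh.eigenvalues i) ^ 2 +
      ((hBh.eigenvalues j)⁻¹ - (hAh.eigenvalues i)⁻¹) ^ 2) :=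
    mul_le_mul_of_nonneg_right hci (by positivity)
  have hfin := mul_le_mul_of_nonneg_left (hs.trans hlin) (hw i j)
  rw [← abs_of_nonneg (hw i j), ← abs_mul, abs_of_nonneg (hw i j)] at hfin
  generalize ∑ i, c i = K at *
  convert! hfin using 1
  · congr 1
    ring
  · ring

section Derivatives

attribute [local instance] frobeniusTopology

theorem hasDerivWithinAt_of_abs_sub_le {g k : ℝ → ℝ} {s : Set ℝ} {t : ℝ}
    (hk : HasDerivWithinAt k 0 s t) (hkt : k t = 0) (h : ∀ r ∈ s, |g r - g t| ≤ k r) :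
    HasDerivWithinAt g 0 s t := by
  rw [hasDerivWithinAt_iff_isLittleO] at hk ⊢
  simp only [smul_zero, sub_zero, hkt] at hk ⊢
  refine (Asymptotics.IsBigO.of_bound 1 ?_).trans_isLittleO hk
  filter_upwards [self_mem_nhdsWithin] with r hr
  rw [one_mul, Real.norm_eq_abs]
  exact (h r hr).trans (le_abs_self _)

/-- The Taylor remainder is dominated by an expression quadratic in `X r - X t` and `(X r)⁻¹ - (X
t)⁻¹`, whose value and derivative vanish at `t`. Only the linear term contributes. -/
theorem hasDerivWithinAt_norm_hlog_sq {X : ℝ → Matrix (Fin p) (Fin p) ℂ}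
    {X' : Matrix (Fin p) (Fin p) ℂ} {s : Set ℝ} {t : ℝ} (hX : HasDerivWithinAt X X' s t)
    (hpd : ∀ r ∈ s, (X r).PosDef) (ht : t ∈ s) :
    HasDerivWithinAt (fun r => ‖hlog (X r)‖ ^ 2) (2 * (hlog (X t) * (X t)⁻¹ * X').trace.re) s t := by
  obtain ⟨C, hC⟩ := abs_norm_hlog_sq_taylor_le (hpd t ht)
  have hl := (hasDerivWithinAt_reTrace ((hX.sub_const (X t)).const_mul
    (hlog (X t) * (X t)⁻¹))).const_mul 2
  have d1 := hX.sub_const (X t)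
  have d2 := (hasDerivWithinAt_matrix_inv hX (hpd t ht).isUnit).sub_const (X t)⁻¹
  have hk := ((hasDerivWithinAt_reTrace (d1.mul d1)).add
    (hasDerivWithinAt_reTrace (d2.mul d2))).const_mul C
  have hg : HasDerivWithinAt (fun r => ‖hlog (X r)‖ ^ 2 -
      2 * (hlog (X t) * (X t)⁻¹ * (X r - X t)).trace.re) 0 s t := by
    refine hasDerivWithinAt_of_abs_sub_le (k := fun r =>
      C * (((X r - X t) * (X r - X t)).trace.re +
        (((X r)⁻¹ - (X t)⁻¹) * ((X r)⁻¹ - (X t)⁻¹)).trace.re)) ?_ (by simp) fun r hr => ?_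
    · convert! hk using 1
      simp
    · have := hC (X r) (hpd r hr)
      simp only [sub_self, mul_zero, Matrix.trace_zero, Complex.zero_re, sub_zero]
      rwa [sub_right_comm]
  convert! hg.add hl using 1
  · funext r
    simp
  · simp

end Derivatives

/-- Because `hlog X` commutes with `X^(-1/2)`, the trace is the Frobenius product of `hlog X` with
the whitened `V`. Cauchy–Schwarz for `hlog X` and for its negative gives both signs. -/
theorem trace_hlog_mul_le {X V : Matrix (Fin p) (Fin p) ℂ} (hX : X.PosDef) (hV : V.IsHermitian) :
    (hlog X * X⁻¹ * V).trace.re ^ 2 ≤ ‖hlog X‖ ^ 2 * metricHPD X V V := by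
  have hc : hlog X * hpow X (-(1 / 2)) = hpow X (-(1 / 2)) * hlog X := by
    rw [hlog, hpow, cfc_mul_of_matrix, cfc_mul_of_matrix]
    simp only [mul_comm]
  have h1 : (hlog X * X⁻¹ * V).trace = (hlog X * whiten X V).trace := by
    rw [whiten, ← neg_half_mul_neg_half hX]
    simp only [← mul_assoc]
    rw [hc, mul_assoc, mul_assoc, Matrix.trace_mul_comm]
    simp only [← mul_assoc]
    rw [hc]
  have hW := isHermitian_whiten (A := X) hV
  have h2 := trace_mul_le_norm_mul_norm (isHermitian_hlog X) hW
  have h3 := trace_mul_le_norm_mul_norm (isHermitian_hlog X).neg hW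
  rw [neg_mul, Matrix.trace_neg, Complex.neg_re, norm_neg] at h3
  rw [h1, metricHPD_self hX hV, ← mul_pow]
  exact sq_le_sq' (by linarith) h2

/-- Invariance under congruence: whitening changes `X⁻¹ V` only by a conjugation. -/
theorem metricHPD_whiten {A X : Matrix (Fin p) (Fin p) ℂ} (hA : A.PosDef)
    (V : Matrix (Fin p) (Fin p) ℂ) :
    metricHPD (whiten A X) (whiten A V) (whiten A V) = metricHPD X V V := by
  have hq : (hpow A (-(1 / 2)))⁻¹ = hpow A (1 / 2) := Matrix.inv_eq_left_inv (half_mul_neg_half hA)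
  have h1 : (whiten A X)⁻¹ * whiten A V = hpow A (1 / 2) * (X⁻¹ * V) * hpow A (-(1 / 2)) := by
    rw [whiten, Matrix.mul_inv_rev, Matrix.mul_inv_rev, hq, whiten]
    simp only [mul_assoc]
    rw [← mul_assoc (hpow A (1 / 2)) (hpow A (-(1 / 2))), half_mul_neg_half hA, one_mul]
  rw [metricHPD, mul_assoc, h1, metricHPD, mul_assoc (X⁻¹ * V)]
  congr 1
  rw [mul_assoc, mul_assoc, Matrix.trace_mul_comm]
  simp only [mul_assoc]
  rw [neg_half_mul_half hA, mul_one, ← mul_assoc (hpow A (-(1 / 2))), neg_half_mul_half hA, one_mul]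

/-- If `E` grows at rate at most `2 √E σ`, then `√E` grows at most by the integral of `σ`. -/
theorem sqrt_le_integral_of_deriv_le {E E' σ : ℝ → ℝ} (hE : ∀ t ∈ Icc (0 : ℝ) 1, 0 ≤ E t)
    (hσ0 : ∀ t ∈ Icc (0 : ℝ) 1, 0 ≤ σ t)
    (hd : ∀ t ∈ Icc (0 : ℝ) 1, HasDerivWithinAt E (E' t) (Icc 0 1) t)
    (hσ : ContinuousOn σ (Icc 0 1)) (h0 : E 0 = 0)
    (hle : ∀ t ∈ Icc (0 : ℝ) 1, E' t ≤ 2 * √(E t) * σ t) :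
    √(E 1) ≤ ∫ t in (0 : ℝ)..1, σ t := by
  -- The square root is not differentiable at `0`, where `E` starts, so `√(E + ε ^ 2)` is used
  -- instead.
  refine le_of_forall_pos_le_add fun ε hε => ?_
  have hpos : ∀ t ∈ Icc (0 : ℝ) 1, 0 < E t + ε ^ 2 := fun t ht => by
    have := hE t ht
    positivity
  have hd2 : ∀ t ∈ Icc (0 : ℝ) 1, HasDerivWithinAt (fun t => √(E t + ε ^ 2))
      (E' t / (2 * √(E t + ε ^ 2))) (Icc 0 1) t := fun t ht =>
    ((hd t ht).add_const _).sqrt (hpos t ht).ne'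
  have h := intervalIntegral.sub_le_integral_of_hasDeriv_right_of_le (zero_le_one (α := ℝ))
    (fun t ht => (hd2 t ht).continuousWithinAt)
    (fun t ht => ((hd2 t (Ioo_subset_Icc_self ht)).hasDerivAt
      (Icc_mem_nhds ht.1 ht.2)).hasDerivWithinAt)
    hσ.integrableOn_Icc (fun t ht => by
      have ht' := Ioo_subset_Icc_self ht
      have hs : 0 < √(E t + ε ^ 2) := Real.sqrt_pos.2 (hpos t ht')
      rw [div_le_iff₀ (by positivity)]
      have h1 : √(E t) ≤ √(E t + ε ^ 2) := Real.sqrt_le_sqrt (by nlinarith)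
      nlinarith [hle t ht', mul_le_mul_of_nonneg_right h1 (hσ0 t ht')])
  have h2 : √(E 1) ≤ √(E 1 + ε ^ 2) := Real.sqrt_le_sqrt (by nlinarith)
  rw [h0, zero_add, Real.sqrt_sq hε.le] at h
  linarith

end Distance

/-! ### The length of the joining geodesic and its minimality -/

section RiemannianDistance

variable {p n : ℕ}

/-- The energy of the Riemannian logarithm of `θ` at `θ₀`, that is, the squared distance. -/
def logEnergy (θ₀ θ : Param p n) : ℝ :=
  (1 / (p : ℝ)) * ‖hlog (whiten θ₀.1 θ.1)‖ ^ 2 +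
    (1 / (n : ℝ)) * ∑ i, Real.log ((θ₀.2 i)⁻¹ * θ.2 i) ^ 2

theorem logEnergy_nonneg (θ₀ θ : Param p n) : 0 ≤ logEnergy θ₀ θ := by
  unfold logEnergy
  positivity

theorem hlog_one : hlog (1 : Matrix (Fin p) (Fin p) ℂ) = 0 := by
  rw [← NormedSpace.exp_zero, hlog_exp Matrix.isHermitian_zero]

theorem whiten_self {A : Matrix (Fin p) (Fin p) ℂ} (hA : A.PosDef) : whiten A A = 1 := by
  have h := whiten_half_conj hA 1
  rwa [mul_one, half_mul_half hA] at h

theorem logEnergy_self {θ : Param p n} (hθ : θ ∈ paramManifold p n) : logEnergy θ θ = 0 := by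
  have h : ∀ i, Real.log ((θ.2 i)⁻¹ * θ.2 i) = 0 := fun i => by
    rw [inv_mul_cancel₀ (ne_zero_of_mem_PosVec hθ.2 i), Real.log_one]
  simp [logEnergy, whiten_self hθ.1.1, hlog_one, h]

theorem metricPosVec_self (τ ξ : Fin n → ℝ) : metricPosVec τ ξ ξ = ∑ i, (ξ i * (τ i)⁻¹) ^ 2 := by
  simp only [metricPosVec, sq]

theorem fisherMetric_self_nonneg {θ ξ : Param p n} (hθ : θ.1.PosDef) (hξ : ξ.1.IsHermitian) :
    0 ≤ fisherMetric θ ξ ξ := by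
  rw [fisherMetric, metricHPD_self hθ hξ, metricPosVec_self]
  positivity

theorem fisherMetric_logParam {θ₀ θ₁ : Param p n} (h₀ : θ₀ ∈ paramManifold p n) :
    fisherMetric θ₀ (logParam θ₀ θ₁) (logParam θ₀ θ₁) = logEnergy θ₀ θ₁ := by
  rw [fisherMetric, metricPosVec_self, metricHPD_self (ξ := (logParam θ₀ θ₁).1) h₀.1.1
    (isHermitian_conj (isHermitian_hpow _ _) (isHermitian_hlog _)), logEnergy, logParam,
    whiten_half_conj h₀.1.1]
  congr 2
  refine Finset.sum_congr rfl fun i _ => ?_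
  have := ne_zero_of_mem_PosVec h₀.2 i
  congr 1
  field_simp

theorem metricHPD_mul_left {X : Matrix (Fin p) (Fin p) ℂ} (hX : X.PosDef)
    (C : Matrix (Fin p) (Fin p) ℂ) : metricHPD X (X * C) (X * C) = (C * C).trace.re := by
  have h : X⁻¹ * (X * C) = C := by rw [← mul_assoc, inv_mul_cancel_of_posDef hX, one_mul]
  rw [metricHPD, mul_assoc _ X⁻¹, h]

theorem metricPosVec_mul_left {τ : Fin n → ℝ} (hτ : τ ∈ PosVec n) (c : Fin n → ℝ) :
    metricPosVec τ (fun i => τ i * c i) (fun i => τ i * c i) = ∑ i, c i ^ 2 := by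
  rw [metricPosVec_self]
  refine Finset.sum_congr rfl fun i _ => ?_
  rw [mul_right_comm, mul_inv_cancel₀ (ne_zero_of_mem_PosVec hτ i), one_mul]

section Derivatives

attribute [local instance] frobeniusTopology

/-- Constant speed: the velocity at `X` is `X C` with `C` fixed, and its squared norm `tr (C²)` does
not involve `X`. -/
theorem fisherMetric_expCurve {θ ξ : Param p n} (hθ : θ ∈ paramManifold p n)
    (hξ : ξ ∈ tangentParam θ) {t : ℝ} (ht : t ∈ Icc (0 : ℝ) 1) :
    fisherMetric (expCurve θ ξ t) (derivWithin (expCurve θ ξ) (Icc 0 1) t)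
      (derivWithin (expCurve θ ξ) (Icc 0 1) t) = fisherMetric θ ξ ξ := by
  have hm := expCurve_mem hθ hξ t
  have key : ∀ r, expCurve θ ξ r ∈ paramManifold p n →
      fisherMetric (expCurve θ ξ r) ((expCurve θ ξ r).1 * (θ.1⁻¹ * ξ.1),
        fun i => (expCurve θ ξ r).2 i * ((θ.2 i)⁻¹ * ξ.2 i))
        ((expCurve θ ξ r).1 * (θ.1⁻¹ * ξ.1),
        fun i => (expCurve θ ξ r).2 i * ((θ.2 i)⁻¹ * ξ.2 i)) =
      (1 / (p : ℝ)) * (θ.1⁻¹ * ξ.1 * (θ.1⁻¹ * ξ.1)).trace.re +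
        (1 / (n : ℝ)) * ∑ i, ((θ.2 i)⁻¹ * ξ.2 i) ^ 2 := fun r hr => by
    rw [fisherMetric, metricHPD_mul_left hr.1.1, metricPosVec_mul_left hr.2]
  have hd : derivWithin (expCurve θ ξ) (Icc 0 1) t = _ :=
    (hasDerivAt_expCurve θ ξ t).hasDerivWithinAt.derivWithin (uniqueDiffOn_Icc_zero_one t ht)
  rw [hd, key t hm, fisherMetric, metricHPD, metricPosVec_self, mul_assoc (θ.1⁻¹ * ξ.1)]
  simp only [mul_comm]

theorem curveLength_joinCurve {θ₀ θ₁ : Param p n} (h₀ : θ₀ ∈ paramManifold p n)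
    (h₁ : θ₁ ∈ paramManifold p n) :
    curveLength fisherMetric (joinCurve θ₀ θ₁) = √(logEnergy θ₀ θ₁) := by
  have h : EqOn (fun t => √(fisherMetric (joinCurve θ₀ θ₁ t)
      (derivWithin (joinCurve θ₀ θ₁) (Icc 0 1) t) (derivWithin (joinCurve θ₀ θ₁) (Icc 0 1) t)))
      (fun _ => √(logEnergy θ₀ θ₁)) (uIcc 0 1) := fun t ht => by
    rw [uIcc_of_le zero_le_one] at ht
    simp only
    rw [joinCurve_eq_expCurve h₀ h₁, fisherMetric_expCurve h₀ (logParam_mem h₀ h₁) ht,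
      fisherMetric_logParam h₀]
  rw [curveLength]
  refine (intervalIntegral.integral_congr h).trans ?_
  simp

theorem continuousOn_speed {γ : ℝ → Param p n} (hγ : ContDiffOn ℝ 1 γ (Icc 0 1))
    (hm : MapsTo γ (Icc 0 1) (paramManifold p n)) :
    ContinuousOn (fun t => √(fisherMetric (γ t) (derivWithin γ (Icc 0 1) t)
      (derivWithin γ (Icc 0 1) t))) (Icc 0 1) := by
  have hc' : ContinuousOn (derivWithin γ (Icc 0 1)) (Icc 0 1) :=
    hγ.continuousOn_derivWithin uniqueDiffOn_Icc_zero_one le_rfl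
  have hi : ContinuousOn (fun t => ((γ t).1)⁻¹) (Icc 0 1) := fun t ht =>
    (contDiffWithinAt_matrix_inv (hγ.fst t ht) (hm ht).1.1.isUnit).continuousWithinAt
  have h1 : ContinuousOn (fun t => reTrace p (((γ t).1)⁻¹ * (derivWithin γ (Icc 0 1) t).1 *
      ((γ t).1)⁻¹ * (derivWithin γ (Icc 0 1) t).1)) (Icc 0 1) :=
    (reTrace p).continuous.comp_continuousOn (((hi.mul hc'.fst).mul hi).mul hc'.fst)
  have h2 : ContinuousOn (fun t => metricPosVec (γ t).2 (derivWithin γ (Icc 0 1) t).2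
      (derivWithin γ (Icc 0 1) t).2) (Icc 0 1) := by
    have ha : ∀ i, ContinuousOn (fun t => (derivWithin γ (Icc 0 1) t).2 i * ((γ t).2 i)⁻¹)
        (Icc 0 1) := fun i => by
      refine ContinuousOn.mul ((continuous_apply i).comp_continuousOn hc'.snd) ?_
      exact ContinuousOn.inv₀ ((continuous_apply i).comp_continuousOn hγ.continuousOn.snd)
        fun t ht => ne_zero_of_mem_PosVec (hm ht).2 i
    exact continuousOn_finsetSum _ fun i _ => (ha i).mul (ha i)
  exact ((continuousOn_const.mul h1).add (continuousOn_const.mul h2)).sqrt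

theorem hasDerivWithinAt_whiten (A : Matrix (Fin p) (Fin p) ℂ)
    {γ : ℝ → Matrix (Fin p) (Fin p) ℂ} {V : Matrix (Fin p) (Fin p) ℂ} {s : Set ℝ} {t : ℝ}
    (h : HasDerivWithinAt γ V s t) :
    HasDerivWithinAt (fun r => whiten A (γ r)) (whiten A V) s t :=
  (h.const_mul _).mul_const _

/-- The distance formula bounds the length of every curve from below. -/
theorem sqrt_logEnergy_le_curveLength {θ₀ : Param p n} (h₀ : θ₀ ∈ paramManifold p n)
    {γ : ℝ → Param p n} (hγ : ContDiffOn ℝ 1 γ (Icc 0 1))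
    (hm : MapsTo γ (Icc 0 1) (paramManifold p n)) (hγ0 : γ 0 = θ₀) :
    √(logEnergy θ₀ (γ 1)) ≤ curveLength fisherMetric γ := by
  have hdiff : DifferentiableOn ℝ γ (Icc 0 1) := hγ.differentiableOn one_ne_zero
  have hT : ∀ t ∈ Icc (0 : ℝ) 1, derivWithin γ (Icc 0 1) t ∈ tangentParam (γ t) := fun t ht =>
    derivWithin_mem_tangentParam (hdiff t ht) (uniqueDiffOn_Icc_zero_one t ht) ht hm
  set V := derivWithin γ (Icc 0 1) with hV
  refine sqrt_le_integral_of_deriv_le (E := fun t => logEnergy θ₀ (γ t))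
    (E' := fun t => (1 / (p : ℝ)) * (2 * (hlog (whiten θ₀.1 (γ t).1) * (whiten θ₀.1 (γ t).1)⁻¹ *
        whiten θ₀.1 (V t).1).trace.re) +
      (1 / (n : ℝ)) * ∑ i, 2 * (Real.log ((θ₀.2 i)⁻¹ * (γ t).2 i) * ((V t).2 i * ((γ t).2 i)⁻¹)))
    (fun t _ => logEnergy_nonneg _ _) (fun t _ => Real.sqrt_nonneg _) (fun t ht => ?_)
    (continuousOn_speed hγ hm) (by rw [hγ0]; exact logEnergy_self h₀) fun t ht => ?_
  · have hd := (hdiff t ht).hasDerivWithinAt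
    have hd1 : HasDerivWithinAt (fun r => (γ r).1) (V t).1 (Icc 0 1) t :=
      hasDerivWithinAt_fst hd
    have hd2 : HasDerivWithinAt (fun r => (γ r).2) (V t).2 (Icc 0 1) t :=
      hasDerivWithinAt_snd hd
    have e1 := hasDerivWithinAt_norm_hlog_sq (hasDerivWithinAt_whiten θ₀.1 hd1)
      (fun r hr => posDef_whiten h₀.1.1 (hm hr).1.1) ht
    refine (e1.const_mul _).add (HasDerivWithinAt.const_mul _ ?_)
    refine HasDerivWithinAt.fun_sum fun i _ => ?_
    have h1 := h₀.2 i
    have h2 := (hm ht).2 i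
    have e2 := (((hasDerivWithinAt_pi.1 hd2) i).const_mul (θ₀.2 i)⁻¹).log (by positivity)
    convert! e2.fun_pow 2 using 1
    field_simp
    ring
  · have hH := (hT t ht).1.1
    have hpd := (hm ht).1.1
    have k1 := trace_hlog_mul_le (posDef_whiten h₀.1.1 hpd) (isHermitian_whiten (A := θ₀.1) hH)
    rw [metricHPD_whiten h₀.1.1] at k1
    have k2 := Finset.sum_mul_sq_le_sq_mul_sq Finset.univ
      (fun i => Real.log ((θ₀.2 i)⁻¹ * (γ t).2 i)) (fun i => (V t).2 i * ((γ t).2 i)⁻¹)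
    have hg0 := fisherMetric_self_nonneg (ξ := V t) hpd hH
    -- What remains is Cauchy–Schwarz for the weighted sum of the two factors, given `x² ≤ a b` and
    -- `y² ≤ c d` in the abbreviations below.
    rw [mul_assoc (2 : ℝ), ← Real.sqrt_mul (logEnergy_nonneg _ _)]
    rw [← Finset.mul_sum, ← hV]
    simp only [fisherMetric, logEnergy, metricPosVec_self]
    have hmet : 0 ≤ metricHPD (γ t).1 (V t).1 (V t).1 := by
      rw [metricHPD_self hpd hH]
      positivity
    have hsum : 0 ≤ ∑ i, ((V t).2 i * ((γ t).2 i)⁻¹) ^ 2 := by positivity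
    have hsum' : 0 ≤ ∑ i, Real.log ((θ₀.2 i)⁻¹ * (γ t).2 i) ^ 2 := by positivity
    have hsq := sq_nonneg ‖hlog (whiten θ₀.1 (γ t).1)‖
    generalize (hlog (whiten θ₀.1 (γ t).1) * _ * _).trace.re = x at *
    generalize ∑ i, Real.log ((θ₀.2 i)⁻¹ * (γ t).2 i) * _ = y at *
    generalize ‖hlog (whiten θ₀.1 (γ t).1)‖ ^ 2 = a at *
    generalize metricHPD (γ t).1 (V t).1 (V t).1 = b at *
    generalize ∑ i, Real.log ((θ₀.2 i)⁻¹ * (γ t).2 i) ^ 2 = c at *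
    generalize ∑ i, ((V t).2 i * ((γ t).2 i)⁻¹) ^ 2 = d at *
    have hp : 0 ≤ 1 / (p : ℝ) := by positivity
    have hn : 0 ≤ 1 / (n : ℝ) := by positivity
    generalize 1 / (p : ℝ) = P at *
    generalize 1 / (n : ℝ) = N at *
    -- The cross term: `(2 x y)² ≤ 4 a b c d ≤ (a d + b c)²`.
    have hxy : 2 * (x * y) ≤ a * d + b * c := by
      refine le_of_abs_le (abs_le_of_sq_le_sq ?_ (by positivity))
      have hm := mul_le_mul k1 k2 (sq_nonneg _) (by positivity)
      nlinarith [sq_nonneg (a * d - b * c)]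
    have hkey : P * x + N * y ≤ √((P * a + N * c) * (P * b + N * d)) := by
      refine Real.le_sqrt_of_sq_le ?_
      have u1 := mul_le_mul_of_nonneg_left k1 (mul_nonneg hp hp)
      have u2 := mul_le_mul_of_nonneg_left k2 (mul_nonneg hn hn)
      have u3 := mul_le_mul_of_nonneg_left hxy (mul_nonneg hp hn)
      nlinarith
    linarith

end Derivatives

theorem norm_toLp_sq (v : Fin n → ℝ) : ‖WithLp.toLp 2 v‖ ^ 2 = ∑ i, v i ^ 2 := by
  rw [EuclideanSpace.norm_sq_eq]
  simp

theorem isLeast_curveLengths (hp : 0 < p) (hn : 0 < n) {θ₀ θ₁ : Param p n}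
    (h₀ : θ₀ ∈ paramManifold p n) (h₁ : θ₁ ∈ paramManifold p n) :
    IsLeast (curveLengths (paramManifold p n) fisherMetric θ₀ θ₁) √(logEnergy θ₀ θ₁) := by
  constructor
  · obtain ⟨hc, hm, -⟩ := isGeodesicOn_expCurve hp hn h₀ (logParam_mem h₀ h₁)
    rw [← joinCurve_eq_expCurve h₀ h₁] at hc hm
    exact ⟨joinCurve θ₀ θ₁, (hc.mono (subset_univ _)).of_le (by simp), fun t _ => hm (mem_univ t),
      joinCurve_zero h₀ h₁, joinCurve_one h₀ h₁, curveLength_joinCurve h₀ h₁⟩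
  · rintro L ⟨γ, hc, hm, h0, h1, rfl⟩
    rw [← h1]
    exact sqrt_logEnergy_le_curveLength h₀ hc hm h0

end RiemannianDistance

end CompoundGaussian

end

open CompoundGaussian
theorem proposition2 (p n : ℕ) (hp : 0 < p) (hn : 0 < n) :
    -- geodesics are exactly the pairs of geodesics of the two factors
    (∀ (γ : ℝ → Param p n) (J : Set ℝ), J.OrdConnected → J.Nontrivial →
      (IsGeodesicOn (paramManifold p n) tangentParam fisherMetric γ J ↔
        IsGeodesicOn (SHPD p) tangentSHPD metricHPD (fun t => (γ t).1) J ∧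
        IsGeodesicOn (PosVec n) tangentPosVec metricPosVec (fun t => (γ t).2) J)) ∧
    -- the geodesic with given initial point and velocity
    (∀ θ ∈ paramManifold p n, ∀ ξ ∈ tangentParam θ,
      IsGeodesicOn (paramManifold p n) tangentParam fisherMetric (expCurve θ ξ) univ ∧
      expCurve θ ξ 0 = θ ∧ HasDerivAt (expCurve θ ξ) ξ 0 ∧
      ∀ (γ : ℝ → Param p n) (J : Set ℝ), J.OrdConnected → J.Nontrivial → 0 ∈ J →
        IsGeodesicOn (paramManifold p n) tangentParam fisherMetric γ J →
        γ 0 = θ → derivWithin γ J 0 = ξ → EqOn γ (expCurve θ ξ) J) ∧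
    -- the geodesic between two given points
    (∀ θ₀ ∈ paramManifold p n, ∀ θ₁ ∈ paramManifold p n,
      IsGeodesicOn (paramManifold p n) tangentParam fisherMetric (joinCurve θ₀ θ₁) univ ∧
      joinCurve θ₀ θ₁ 0 = θ₀ ∧ joinCurve θ₀ θ₁ 1 = θ₁ ∧
      ∀ (γ : ℝ → Param p n) (J : Set ℝ), J.OrdConnected → 0 ∈ J → 1 ∈ J →
        IsGeodesicOn (paramManifold p n) tangentParam fisherMetric γ J →
        γ 0 = θ₀ → γ 1 = θ₁ → EqOn γ (joinCurve θ₀ θ₁) J) ∧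
    -- the Riemannian distance
    (∀ θ₀ ∈ paramManifold p n, ∀ θ₁ ∈ paramManifold p n,
      (curveLengths (paramManifold p n) fisherMetric θ₀ θ₁).Nonempty ∧
      riemannianDist (paramManifold p n) fisherMetric θ₀ θ₁ ^ 2 =
        (1 / (p : ℝ)) * ‖hlog (whiten θ₀.1 θ₁.1)‖ ^ 2 +
        (1 / (n : ℝ)) *
          ‖WithLp.toLp 2 (fun i => Real.log ((θ₀.2 i)⁻¹ * θ₁.2 i))‖ ^ 2) := by
  refine ⟨fun γ J hJ hJn =>
      isGeodesicOn_fisherMetric_iff hp hn (uniqueDiffOn_of_ordConnected hJ hJn),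
    fun θ hθ ξ hξ => ⟨isGeodesicOn_expCurve hp hn hθ hξ, expCurve_zero θ ξ,
      hasDerivAt_expCurve_zero hθ ξ, fun γ J hJ hJn h0 hγ hγ0 hγ' => ?_⟩,
    fun θ₀ h₀ θ₁ h₁ => ⟨?_, joinCurve_zero h₀ h₁, joinCurve_one h₀ h₁,
      fun γ J hJ h0 h1 hγ hγ0 hγ1 => ?_⟩,
    fun θ₀ h₀ θ₁ h₁ => ?_⟩
  · have h := geodesic_eq_expCurve hp hn hJ hJn h0 hγ
    rw [hγ0] at h
    exact hγ' ▸ h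
  · rw [joinCurve_eq_expCurve h₀ h₁]
    exact isGeodesicOn_expCurve hp hn h₀ (logParam_mem h₀ h₁)
  · rw [← hγ0, ← hγ1]
    exact geodesic_eq_joinCurve hp hn hJ h0 h1 hγ
  · have h := isLeast_curveLengths hp hn h₀ h₁
    refine ⟨h.nonempty, ?_⟩
    rw [riemannianDist, h.csInf_eq, Real.sq_sqrt (logEnergy_nonneg _ _), logEnergy, norm_toLp_sq]
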